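/- Let $n\ge 1$, $H\in(0,1)$, and let $\{X_u\}_{u\in\mathbf R^n}$ be an $n$-dimensional Lévy fractional Brownian motion with Hurst parameter $H$ on a probability space $(\Omega,\mathcal F,P)$, i.e. a centred real Gaussian process with covariance $$\mathbf E\,X_uX_v=\tfrac12\bigl(|u|^{2H}+|v|^{2H}-|u-v|^{2H}\bigr),\qquad u,v\in\mathbf R^n .$$ For an open ball $B(s,\varepsilon)\subset\mathbf R^n$ let $E_{B(s,\varepsilon)}\subset L^2(P)$ be the closed linear span of the differences $X_u-X_v$, $u,v\in B(s,\varepsilon)$. For closed subspaces $A,B$ of $L^2(P)$ define the angle $\sphericalangle(A,B)\in[0,\pi]$ by $$\cos\sphericalangle(A,B)=\sup\Bigl\{\frac{(U,V)}{\|U\|\,\|V\|}:\ U\in A\setminus\{0\},\ V\in B\setminus\{0\}\Bigr\},$$ and the mutual (Shannon) information $$I(A:B)=\sup\sum_{j,k}P(A_j\cap B_k)\log\frac{P(A_j\cap B_k)}{P(A_j)P(B_k)}\in[0,\infty],$$ where the supremum is over all finite partitions $\{A_j\}$, $\{B_k\}$ of $\Omega$ into sets of positive probability measurable with respect to $\sigma(A)$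 and $\sigma(B)$, the $\sigma$-algebras generated by the random variables in $A$ and in $B$, and $0\log 0=0$. Let $s_1\neq s_2$ in $\mathbf R^n$. Then $E_{B(s_1,\varepsilon)}$ and $E_{B(s_2,\varepsilon)}$ are asymptotically independent as $\varepsilon\searrow0$, in the weak and in the strong sense: $$\sphericalangle\bigl(E_{B(s_1,\varepsilon)},E_{B(s_2,\varepsilon)}\bigr)\to\frac{\pi}{2}\qquad\text{and}\qquad I\bigl(E_{B(s_1,\varepsilon)}:E_{B(s_2,\varepsilon)}\bigr)\to 0 .$$ Moreover, there are constants $c_1,c_2>0$ and $\varepsilon_0>0$ such that for all $0<\varepsilon<\varepsilon_0$ $$\cos\sphericalangle\bigl(E_{B(s_1,\varepsilon)},E_{B(s_2,\varepsilon)}\bigr)\le c_2\,\varepsilon^{2-2H},$$ and, unless $n=1$ and $H=\tfrac12$, $$c_1\,\varepsilon^{2-2H}\le\cos\sphericalangle\bigl(E_{B(s_1,\varepsilon)},E_{B(s_2,\varepsilon)}\bigr).$$ -/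

import Mathlib

open MeasureTheory ProbabilityTheory Filter Topology

noncomputable section

namespace LevyFBM

/-- `X` is an `n`-dimensional Lévy fractional Brownian motion with Hurst parameter `H`: a centred
Gaussian process indexed by `ℝⁿ` (with the Euclidean norm) whose covariance is
`E[X_u X_v] = (|u|^{2H} + |v|^{2H} - |u - v|^{2H}) / 2`. -/
structure IsLevyFBM {Ω : Type*} [MeasurableSpace Ω] {n : ℕ} (H : ℝ)
    (X : EuclideanSpace ℝ (Fin n) → Ω → ℝ) (P : Measure Ω) : Prop where
  isGaussianProcess : IsGaussianProcess X P
  centered : ∀ u, ∫ ω, X u ω ∂P = 0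
  covariance_eq : ∀ u v, ∫ ω, X u ω * X v ω ∂P =
    (1 / 2 : ℝ) * (‖u‖ ^ (2 * H) + ‖v‖ ^ (2 * H) - ‖u - v‖ ^ (2 * H))

/-- The increment space `E_S`: the closed linear span in `L²(P)` of the (classes of the) differences
`X_u - X_v` with `u, v ∈ S`. -/
def incrementSpace {Ω : Type*} [MeasurableSpace Ω] {T : Type*} (X : T → Ω → ℝ) (P : Measure Ω)
    (S : Set T) : Submodule ℝ (Lp ℝ 2 P) :=
  (Submodule.span ℝ {h : Lp ℝ 2 P | ∃ u ∈ S, ∃ v ∈ S,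
    (h : Ω → ℝ) =ᵐ[P] fun ω => X u ω - X v ω}).topologicalClosure

/-- The cosine of the angle between two subspaces of a real Hilbert space:
`sup {⟪U, V⟫ / (‖U‖ ‖V‖) : U ∈ A, V ∈ B}` over nonzero `U`, `V`. The set is bounded by `1`. -/
def cosAngle {E : Type*} [NormedAddCommGroup E] [InnerProductSpace ℝ E]
    (A B : Submodule ℝ E) : ℝ :=
  sSup {r : ℝ | ∃ U ∈ A, ∃ V ∈ B, U ≠ 0 ∧ V ≠ 0 ∧ r = inner ℝ U V / (‖U‖ * ‖V‖)}

/-- The angle between two subspaces of a real Hilbert space. -/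
def angle {E : Type*} [NormedAddCommGroup E] [InnerProductSpace ℝ E]
    (A B : Submodule ℝ E) : ℝ :=
  Real.arccos (cosAngle A B)

/-- `A` is a finite `𝒜`-measurable partition of the probability space into sets of positive
probability. -/
structure IsMeasPartition {Ω : Type*} (𝒜 : MeasurableSpace Ω) [MeasurableSpace Ω] (P : Measure Ω)
    {m : ℕ} (A : Fin m → Set Ω) : Prop where
  measurableSet : ∀ j, MeasurableSet[𝒜] (A j)
  disjoint : Pairwise fun i j => Disjoint (A i) (A j)
  iUnion_eq : ⋃ j, A j = Set.univ
  pos : ∀ j, 0 < P.real (A j)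

/-- Shannon's mutual information `I(𝒜 : ℬ)` of two σ-algebras: the supremum over finite measurable
partitions of `∑ P(A_j ∩ B_k) log (P(A_j ∩ B_k) / (P(A_j) P(B_k)))` (with `0 log 0 = 0`). -/
def mutualInfo {Ω : Type*} (𝒜 ℬ : MeasurableSpace Ω) [MeasurableSpace Ω] (P : Measure Ω) : EReal :=
  sSup {r : EReal | ∃ (m l : ℕ) (A : Fin m → Set Ω) (B : Fin l → Set Ω),
    IsMeasPartition 𝒜 P A ∧ IsMeasPartition ℬ P B ∧
    r = ((∑ j, ∑ k, P.real (A j ∩ B k) *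
      Real.log (P.real (A j ∩ B k) / (P.real (A j) * P.real (B k))) : ℝ) : EReal)}

/-- The σ-algebra generated by the random variables in a subspace of `L²(P)`. Measurable
representatives of the classes are used; other representatives would change the σ-algebra by null
sets only. -/
abbrev sigmaOf {Ω : Type*} [MeasurableSpace Ω] {P : Measure Ω} (A : Submodule ℝ (Lp ℝ 2 P)) :
    MeasurableSpace Ω :=
  ⨆ h : A, MeasurableSpace.comap ((h : Lp ℝ 2 P) : Ω → ℝ) (borel ℝ)

end LevyFBM

end

noncomputable section

set_option linter.unusedSectionVars false

namespace LevyFBM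

open scoped RealInnerProductSpace FourierTransform

/-! ### Spectral representation of the variogram -/

section Spectral

variable {E : Type*} [NormedAddCommGroup E] [InnerProductSpace ℝ E] [FiniteDimensional ℝ E]
  [MeasurableSpace E] [BorelSpace E]

/-! Everything rests on smallness of the characteristic function of an increment at small scale. Let
`a` be a finitely supported signed measure of mass zero, `â` its characteristic function and `d` the
dimension. The variance of the corresponding combination of values of `X` is a constant times `∫
|â(η)|² |η|^{-d-2H} dη`. If `a` lives on the unit ball, multiplying it by a bump function equal to
`1` there changes nothing, so `â` is reproduced by convolution with a Schwartz function. Mass zero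
and Cauchy-Schwarz then give `|â(ζ)| ≤ C |ζ| (1+|ζ|)^M` times the standard deviation
(`exists_sq_norm_charSum_le`). Rescaling to a ball of radius `ε` gains `ε^{1-H}`.

For increments over two distant balls only values of `|u-v|^{2H}` away from the origin matter, and
there this function is the Fourier integral of a Schwartz function `g`. The covariance becomes `-1/2
∫ â conj(b̂) g`, hence is `O(ε^{1-H} · ε^{1-H})` relative to the norms. Bessel's inequality for `a ↦
â(ζ)` at each fixed `ζ` upgrades this to a Hilbert-Schmidt bound (`exists_sum_sq_inner_le`), whose
case of a single pair bounds the cosine.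

For the mutual information, diagonalising the projection from a finite-dimensional part of one
Gaussian space to the other yields independent coordinates with squared correlations `v_i`. The
second moment of the density of the joint law with respect to the product law is `∏ (1 - v_i)⁻¹`,
which the Hilbert-Schmidt norm controls independently of the dimension (`sum_sq_div_le_exp`).
Approximation by cylinder events and `log x ≤ x - 1` finish (`mutualInfo_le_exp_sub_one`).

The lower bound tests the supremum on two parallel increments of length `ε/2`. Their covariance is
half a second difference of `|z|^{2H}` at `s₁ - s₂`, of order `ε²`, while each norm is of order
`ε^H`. The Hessian of `|z|^{2H}` away from the origin vanishes only for `n = 1`, `H = 1/2`. -/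

/-- The spectral density of fractional Brownian motion, up to a constant. -/
def spectralWeight (E : Type*) [NormedAddCommGroup E] [InnerProductSpace ℝ E] (H : ℝ) (η : E) : ℝ :=
  ‖η‖ ^ (-(Module.finrank ℝ E + 2 * H))

lemma spectralWeight_nonneg (H : ℝ) (η : E) : 0 ≤ spectralWeight E H η := by
  unfold spectralWeight; positivity

lemma measurable_spectralWeight (H : ℝ) : Measurable (spectralWeight E H) := by
  unfold spectralWeight; fun_prop

/-- Radial form of the majorant of the spectral integrand. It behaves like `r^{1-2H}` at the origin,
integrable because `H < 1`, and like `r^{-1-2H}` at infinity, integrable because `H > 0`. -/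
lemma integrableOn_min_mul_rpow {d : ℕ} (hd : 0 < d) {H : ℝ} (hH0 : 0 < H) (hH1 : H < 1) (K : ℝ)
    (hK : 0 ≤ K) :
    IntegrableOn (fun r : ℝ => r ^ (d - 1) • (min 2 (K * r ^ 2) * r ^ (-(d + 2 * H))))
      (Set.Ioi 0) := by
  have hm : AEStronglyMeasurable
      (fun r : ℝ => r ^ (d - 1) • (min 2 (K * r ^ 2) * r ^ (-(d + 2 * H))))
      (volume : Measure ℝ) := by
    refine Measurable.aestronglyMeasurable ?_
    simp only [smul_eq_mul]
    fun_prop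
  have key : ∀ r : ℝ, 0 < r → r ^ (d - 1) • (min 2 (K * r ^ 2) * r ^ (-(d + 2 * H))) =
      min 2 (K * r ^ 2) * r ^ (-1 - 2 * H) := by
    intro r hr
    have : r ^ (d - 1) * r ^ (-(d + 2 * H)) = r ^ (-1 - 2 * H) := by
      rw [← Real.rpow_natCast, ← Real.rpow_add hr, Nat.cast_sub hd]
      congr 1; push_cast; ring
    rw [smul_eq_mul, ← this]; ring
  rw [← Set.Ioc_union_Ioi_eq_Ioi (zero_le_one' ℝ)]
  refine IntegrableOn.union ?_ ?_
  · have h1 : IntegrableOn (fun r : ℝ => K * r ^ (1 - 2 * H)) (Set.Ioc 0 1) := by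
      refine Integrable.const_mul ?_ K
      have := intervalIntegral.intervalIntegrable_rpow' (a := 0) (b := 1) (r := 1 - 2 * H)
        (by linarith)
      rwa [intervalIntegrable_iff_integrableOn_Ioc_of_le zero_le_one] at this
    refine Integrable.mono' h1 hm.restrict ?_
    filter_upwards [ae_restrict_mem measurableSet_Ioc] with r hr
    rw [key r hr.1, Real.norm_of_nonneg (by have := hr.1; positivity)]
    calc min 2 (K * r ^ 2) * r ^ (-1 - 2 * H) ≤ K * r ^ 2 * r ^ (-1 - 2 * H) := by
          gcongr
          · have := hr.1; positivity
          · exact min_le_right _ _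
      _ = K * r ^ (1 - 2 * H) := by
          rw [mul_assoc, ← Real.rpow_natCast, ← Real.rpow_add hr.1]; congr 2; push_cast; ring
  · have h1 : IntegrableOn (fun r : ℝ => 2 * r ^ (-1 - 2 * H)) (Set.Ioi 1) :=
      (integrableOn_Ioi_rpow_of_lt (by linarith) one_pos).const_mul 2
    refine Integrable.mono' h1 hm.restrict ?_
    filter_upwards [ae_restrict_mem measurableSet_Ioi] with r hr
    have hr0 : (0 : ℝ) < r := lt_trans one_pos hr
    rw [key r hr0, Real.norm_of_nonneg (by positivity)]
    gcongr
    exact min_le_left _ _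

lemma integrable_one_sub_cos_mul_spectralWeight {H : ℝ} (hH0 : 0 < H) (hH1 : H < 1) (u : E) :
    Integrable (fun η : E => (1 - Real.cos (2 * Real.pi * ⟪u, η⟫)) * spectralWeight E H η) := by
  rcases subsingleton_or_nontrivial E with hE | hE
  · have : (fun η : E => (1 - Real.cos (2 * Real.pi * ⟪u, η⟫)) * spectralWeight E H η) = 0 := by
      ext η; simp [Subsingleton.elim u 0]
    rw [this]; exact integrable_zero _ _ _
  have hint := (integrable_fun_norm_addHaar (volume : Measure E)
    (f := fun r : ℝ => min 2 (((2 * Real.pi * ‖u‖) ^ 2 / 2) * r ^ 2) *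
      r ^ (-(Module.finrank ℝ E + 2 * H)))).2
    (integrableOn_min_mul_rpow Module.finrank_pos hH0 hH1 _ (by positivity))
  refine Integrable.mono' hint ?_ (Eventually.of_forall fun η => ?_)
  · refine Measurable.aestronglyMeasurable ?_
    have := measurable_spectralWeight (E := E) H
    fun_prop
  · have h0 : 0 ≤ 1 - Real.cos (2 * Real.pi * ⟪u, η⟫) := by
      linarith [Real.cos_le_one (2 * Real.pi * ⟪u, η⟫)]
    rw [Real.norm_of_nonneg (mul_nonneg h0 (spectralWeight_nonneg H η))]
    refine mul_le_mul_of_nonneg_right (le_min ?_ ?_) (spectralWeight_nonneg H η)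
    · linarith [Real.neg_one_le_cos (2 * Real.pi * ⟪u, η⟫)]
    · have h1 := Real.one_sub_sq_div_two_le_cos (x := 2 * Real.pi * ⟪u, η⟫)
      have h2 : (2 * Real.pi * ⟪u, η⟫) ^ 2 ≤ (2 * Real.pi * ‖u‖) ^ 2 * ‖η‖ ^ 2 := by
        rw [← mul_pow, sq_le_sq, abs_mul, abs_of_pos Real.two_pi_pos,
          abs_of_nonneg (by positivity : 0 ≤ 2 * Real.pi * ‖u‖ * ‖η‖), mul_assoc _ ‖u‖]
        exact mul_le_mul_of_nonneg_left (abs_real_inner_le_norm u η) Real.two_pi_pos.le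
      linarith

/-- The spectral integral `∫ (1 - cos(2π⟨u, η⟩)) |η|^{-d-2H} dη`. -/
def spectralIntegral (H : ℝ) (u : E) : ℝ :=
  ∫ η : E, (1 - Real.cos (2 * Real.pi * ⟪u, η⟫)) * spectralWeight E H η

/-- Substitute `r • η` for `η`: the weight is homogeneous of degree `-d-2H` and the Jacobian
accounts for `r^d`. -/
lemma spectralIntegral_smul (H : ℝ) (u : E) {r : ℝ} (hr : 0 < r) :
    spectralIntegral H (r • u) = r ^ (2 * H) * spectralIntegral H u := by
  have h := Measure.integral_comp_smul (volume : Measure E)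
    (fun η : E => (1 - Real.cos (2 * Real.pi * ⟪u, η⟫)) * spectralWeight E H η) r
  have h2 : ∀ η : E, (1 - Real.cos (2 * Real.pi * ⟪u, r • η⟫)) * spectralWeight E H (r • η) =
      r ^ (-(Module.finrank ℝ E + 2 * H)) *
        ((1 - Real.cos (2 * Real.pi * ⟪r • u, η⟫)) * spectralWeight E H η) := by
    intro η
    rw [real_inner_smul_left, real_inner_smul_right, spectralWeight, spectralWeight, norm_smul,
      Real.norm_of_nonneg hr.le, Real.mul_rpow hr.le (norm_nonneg _)]
    ring
  simp only [h2, integral_const_mul] at h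
  change _ * spectralIntegral H (r • u) = _ • spectralIntegral H u at h
  rw [abs_of_pos (by positivity), smul_eq_mul] at h
  have h3 : r ^ (-(Module.finrank ℝ E + 2 * H)) =
      (r ^ Module.finrank ℝ E)⁻¹ * (r ^ (2 * H))⁻¹ := by
    rw [Real.rpow_neg hr.le, Real.rpow_add hr, Real.rpow_natCast, mul_inv]
  rw [h3, mul_assoc] at h
  have h4 := mul_left_cancel₀ (by positivity) h
  rw [← h4, ← mul_assoc, mul_inv_cancel₀ (by positivity), one_mul]

/-- The reflection in the hyperplane orthogonal to `u - v` carries `u` to `v` and preserves both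
Lebesgue measure and the weight. -/
lemma spectralIntegral_eq_of_norm_eq (H : ℝ) {u v : E} (h : ‖u‖ = ‖v‖) :
    spectralIntegral H u = spectralIntegral H v := by
  set R := (ℝ ∙ (u - v))ᗮ.reflection
  have hR : R u = v := Submodule.reflection_sub h
  have := (R.measurePreserving).integral_comp R.toHomeomorph.measurableEmbedding
    (fun η : E => (1 - Real.cos (2 * Real.pi * ⟪v, η⟫)) * spectralWeight E H η)
  rw [spectralIntegral, spectralIntegral, ← this]
  refine integral_congr_ae (Eventually.of_forall fun η => ?_)
  simp only [spectralWeight, LinearIsometryEquiv.norm_map]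
  rw [← hR, LinearIsometryEquiv.inner_map_map]

lemma spectralIntegral_pos {H : ℝ} (hH0 : 0 < H) (hH1 : H < 1) {u : E} (hu : ‖u‖ = 1) :
    0 < spectralIntegral H u := by
  have hnn : 0 ≤ fun η : E => (1 - Real.cos (2 * Real.pi * ⟪u, η⟫)) * spectralWeight E H η :=
    fun η => mul_nonneg (by simp only [sub_nonneg]; exact Real.cos_le_one _)
      (spectralWeight_nonneg H η)
  rw [spectralIntegral, integral_pos_iff_support_of_nonneg hnn
    (integrable_one_sub_cos_mul_spectralWeight hH0 hH1 u)]
  -- On this strip the phase lies strictly between `0` and `2π`, so the cosine is not `1`; a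
  -- nonempty open set has positive measure.
  have hopen : IsOpen {η : E | 0 < ⟪u, η⟫ ∧ ⟪u, η⟫ < 1} :=
    (isOpen_lt (f := fun _ : E => (0 : ℝ)) (g := fun η => ⟪u, η⟫) continuous_const
      (by fun_prop)).inter (isOpen_lt (f := fun η : E => ⟪u, η⟫) (g := fun _ => (1 : ℝ))
      (by fun_prop) continuous_const)
  have hne : {η : E | 0 < ⟪u, η⟫ ∧ ⟪u, η⟫ < 1}.Nonempty := by
    refine ⟨(1 / 2 : ℝ) • u, ?_⟩
    simp only [Set.mem_ofPred_eq, real_inner_smul_right, real_inner_self_eq_norm_sq, hu]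
    norm_num
  refine (hopen.measure_pos volume hne).trans_le (measure_mono fun η hη => ?_)
  have hη0 : η ≠ 0 := by
    rintro rfl
    simp at hη
  have h1 : Real.cos (2 * Real.pi * ⟪u, η⟫) ≠ 1 := by
    intro h
    rw [Real.cos_eq_one_iff] at h
    obtain ⟨k, hk⟩ := h
    have h3 : (k : ℝ) = ⟪u, η⟫ := by
      have : (2 * Real.pi) ≠ 0 := by positivity
      apply mul_left_cancel₀ this
      linarith
    have h4 := hη.1
    have h5 := hη.2
    rw [← h3] at h4 h5
    norm_cast at h4 h5
    omega
  refine mul_ne_zero (sub_ne_zero.2 h1.symm) ?_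
  unfold spectralWeight
  positivity

lemma exists_spectralIntegral_eq [Nontrivial E] {H : ℝ} (hH0 : 0 < H) (hH1 : H < 1) :
    ∃ c : ℝ, 0 < c ∧ ∀ u : E, spectralIntegral H u = c * ‖u‖ ^ (2 * H) := by
  obtain ⟨e, he⟩ := exists_norm_eq E zero_le_one
  refine ⟨spectralIntegral H e, spectralIntegral_pos hH0 hH1 he, fun u => ?_⟩
  rcases eq_or_ne u 0 with rfl | hu
  · rw [norm_zero, Real.zero_rpow (by positivity)]
    simp [spectralIntegral]
  · have hpos : 0 < ‖u‖ := norm_pos_iff.2 hu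
    rw [spectralIntegral_eq_of_norm_eq H (v := ‖u‖ • e) (by simp [norm_smul, he]),
      spectralIntegral_smul H e hpos, mul_comm]

/-! ### Characteristic sums and the variance of increments -/

/-- The characteristic sum `∑ a_i e(⟨x_i, η⟩)` of a finite signed measure. -/
def charSum {ι : Type*} (s : Finset ι) (a : ι → ℝ) (x : ι → E) (η : E) : ℂ :=
  ∑ i ∈ s, (a i : ℂ) * (𝐞 ⟪x i, η⟫ : ℂ)

/-- The quadratic form of the variogram: the variance of `∑ a_i X_{x_i}` when `∑ a_i = 0`. -/
def variogramForm {ι : Type*} (H : ℝ) (s : Finset ι) (a : ι → ℝ) (x : ι → E) : ℝ :=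
  -(1 / 2) * ∑ i ∈ s, ∑ j ∈ s, a i * a j * ‖x i - x j‖ ^ (2 * H)

lemma continuous_charSum {ι : Type*} (s : Finset ι) (a : ι → ℝ) (x : ι → E) :
    Continuous (charSum s a x) := by
  unfold charSum
  refine continuous_finsetSum _ fun i _ => continuous_const.mul ?_
  exact continuous_subtype_val.comp (Real.continuous_fourierChar.comp (by fun_prop))

lemma fourierChar_mul_conj (s t : ℝ) :
    ((𝐞 s : ℂ) * (starRingEnd ℂ) (𝐞 t : ℂ)).re = Real.cos (2 * Real.pi * (s - t)) := by
  have h : (starRingEnd ℂ) (𝐞 t : ℂ) = (𝐞 (-t) : ℂ) := by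
    rw [AddChar.map_neg_eq_inv, Circle.coe_inv_eq_conj]
  rw [h, ← Circle.coe_mul, ← AddChar.map_add_eq_mul, Real.fourierChar_apply, ← sub_eq_add_neg]
  have : ((2 * Real.pi * (s - t) : ℝ) : ℂ) * Complex.I =
    ((2 * Real.pi * (s - t) : ℝ) : ℂ) * Complex.I := rfl
  rw [Complex.exp_ofReal_mul_I_re]

lemma norm_sq_charSum {ι : Type*} (s : Finset ι) (a : ι → ℝ) (x : ι → E) (η : E) :
    ‖charSum s a x η‖ ^ 2 =
      ∑ i ∈ s, ∑ j ∈ s, a i * a j * Real.cos (2 * Real.pi * ⟪x i - x j, η⟫) := by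
  have h : ‖charSum s a x η‖ ^ 2 =
      (charSum s a x η * (starRingEnd ℂ) (charSum s a x η)).re := by
    rw [Complex.mul_conj, Complex.ofReal_re, Complex.normSq_eq_norm_sq]
  rw [h, charSum, map_sum, Finset.sum_mul_sum, Complex.re_sum]
  refine Finset.sum_congr rfl fun i _ => ?_
  rw [Complex.re_sum]
  refine Finset.sum_congr rfl fun j _ => ?_
  rw [inner_sub_left, ← fourierChar_mul_conj, map_mul, Complex.conj_ofReal]
  have : (a i : ℂ) * (𝐞 ⟪x i, η⟫ : ℂ) * ((a j : ℂ) * (starRingEnd ℂ) (𝐞 ⟪x j, η⟫ : ℂ)) =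
      ((a i * a j : ℝ) : ℂ) * ((𝐞 ⟪x i, η⟫ : ℂ) * (starRingEnd ℂ) (𝐞 ⟪x j, η⟫ : ℂ)) := by
    push_cast; ring
  rw [this, Complex.re_ofReal_mul]

/-- Mass zero allows `cos` to be replaced by `cos - 1`, which makes each term separately integrable
against the weight, singular at the origin. -/
lemma norm_sq_charSum_eq_sum_one_sub_cos {ι : Type*} (s : Finset ι) (a : ι → ℝ)
    (x : ι → E) (ha : ∑ i ∈ s, a i = 0) (η : E) :
    ‖charSum s a x η‖ ^ 2 =
      -∑ i ∈ s, ∑ j ∈ s, a i * a j * (1 - Real.cos (2 * Real.pi * ⟪x i - x j, η⟫)) := by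
  have h0 : ∑ i ∈ s, ∑ j ∈ s, a i * a j = 0 := by
    rw [← Finset.sum_mul_sum, ha, zero_mul]
  rw [norm_sq_charSum]
  simp only [mul_sub, mul_one, Finset.sum_sub_distrib, h0]
  ring

lemma integrable_norm_sq_charSum_mul {ι : Type*} {H : ℝ} (hH0 : 0 < H) (hH1 : H < 1)
    (s : Finset ι) (a : ι → ℝ) (x : ι → E) (ha : ∑ i ∈ s, a i = 0) :
    Integrable (fun η : E => ‖charSum s a x η‖ ^ 2 * spectralWeight E H η) := by
  simp only [norm_sq_charSum_eq_sum_one_sub_cos s a x ha, neg_mul, Finset.sum_mul]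
  refine Integrable.neg (integrable_finsetSum _ fun i _ => integrable_finsetSum _ fun j _ => ?_)
  simp only [mul_assoc]
  have := (integrable_one_sub_cos_mul_spectralWeight hH0 hH1 (x i - x j)).const_mul (a i * a j)
  simpa only [mul_assoc] using this

lemma integral_norm_sq_charSum_mul {ι : Type*} {H c : ℝ} (hH0 : 0 < H) (hH1 : H < 1)
    (hc : ∀ u : E, spectralIntegral H u = c * ‖u‖ ^ (2 * H))
    (s : Finset ι) (a : ι → ℝ) (x : ι → E) (ha : ∑ i ∈ s, a i = 0) :
    ∫ η : E, ‖charSum s a x η‖ ^ 2 * spectralWeight E H η = 2 * c * variogramForm H s a x := by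
  have hint : ∀ i j, Integrable (fun η : E => a i * a j *
      ((1 - Real.cos (2 * Real.pi * ⟪x i - x j, η⟫)) * spectralWeight E H η)) := fun i j =>
    (integrable_one_sub_cos_mul_spectralWeight hH0 hH1 (x i - x j)).const_mul (a i * a j)
  simp only [norm_sq_charSum_eq_sum_one_sub_cos s a x ha, neg_mul, Finset.sum_mul, mul_assoc]
  simp only [mul_assoc] at hint
  rw [integral_neg, integral_finsetSum _ fun i _ => integrable_finsetSum _ fun j _ => hint i j]
  have : ∀ i ∈ s, ∫ η : E, ∑ j ∈ s, a i * (a j *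
      ((1 - Real.cos (2 * (Real.pi * ⟪x i - x j, η⟫))) * spectralWeight E H η)) =
      ∑ j ∈ s, a i * (a j * (c * ‖x i - x j‖ ^ (2 * H))) := by
    intro i _
    rw [integral_finsetSum _ fun j _ => hint i j]
    refine Finset.sum_congr rfl fun j _ => ?_
    rw [integral_const_mul, integral_const_mul, ← hc, spectralIntegral]
    simp only [mul_assoc]
  rw [Finset.sum_congr rfl this, variogramForm]
  simp only [Finset.mul_sum, ← Finset.sum_neg_distrib]
  refine Finset.sum_congr rfl fun i _ => Finset.sum_congr rfl fun j _ => ?_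
  ring

lemma variogramForm_nonneg {ι : Type*} [Nontrivial E] {H : ℝ} (hH0 : 0 < H) (hH1 : H < 1)
    (s : Finset ι) (a : ι → ℝ) (x : ι → E) (ha : ∑ i ∈ s, a i = 0) :
    0 ≤ variogramForm H s a x := by
  obtain ⟨c, hc, h⟩ := exists_spectralIntegral_eq (E := E) hH0 hH1
  have h1 := integral_norm_sq_charSum_mul hH0 hH1 h s a x ha
  have h2 : 0 ≤ ∫ η : E, ‖charSum s a x η‖ ^ 2 * spectralWeight E H η :=
    integral_nonneg fun η => mul_nonneg (by positivity) (spectralWeight_nonneg H η)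
  rw [h1] at h2
  exact nonneg_of_mul_nonneg_right (by linarith) (by positivity : 0 < 2 * c)

end Spectral

end LevyFBM

end

noncomputable section

set_option linter.unusedSectionVars false

namespace LevyFBM

open scoped RealInnerProductSpace FourierTransform

/-! ### Characteristic sums are controlled by the variogram -/

lemma integrable_mul_of_sq_integrable {α : Type*} [MeasurableSpace α] {μ : Measure α}
    {f g : α → ℝ} (hf : AEStronglyMeasurable f μ) (hg : AEStronglyMeasurable g μ)
    (hf2 : Integrable (fun x => f x ^ 2) μ) (hg2 : Integrable (fun x => g x ^ 2) μ) :
    Integrable (fun x => f x * g x) μ :=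
  ((memLp_two_iff_integrable_sq hf).2 hf2).integrable_mul ((memLp_two_iff_integrable_sq hg).2 hg2)

lemma sq_integral_mul_le {α : Type*} [MeasurableSpace α] {μ : Measure α} {f g : α → ℝ}
    (hf : AEStronglyMeasurable f μ) (hg : AEStronglyMeasurable g μ)
    (hf0 : ∀ x, 0 ≤ f x) (hg0 : ∀ x, 0 ≤ g x)
    (hf2 : Integrable (fun x => f x ^ 2) μ) (hg2 : Integrable (fun x => g x ^ 2) μ) :
    (∫ x, f x * g x ∂μ) ^ 2 ≤ (∫ x, f x ^ 2 ∂μ) * ∫ x, g x ^ 2 ∂μ := by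
  have h := integral_mul_le_Lp_mul_Lq_of_nonneg (μ := μ) Real.HolderConjugate.two_two
    (Eventually.of_forall hf0) (Eventually.of_forall hg0)
    (by simpa using (memLp_two_iff_integrable_sq hf).2 hf2)
    (by simpa using (memLp_two_iff_integrable_sq hg).2 hg2)
  simp only [Real.rpow_two, ← Real.sqrt_eq_rpow] at h
  have h0 : 0 ≤ ∫ x, f x * g x ∂μ := integral_nonneg fun x => mul_nonneg (hf0 x) (hg0 x)
  calc (∫ x, f x * g x ∂μ) ^ 2
      ≤ (√(∫ x, f x ^ 2 ∂μ) * √(∫ x, g x ^ 2 ∂μ)) ^ 2 := by gcongr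
    _ = _ := by
      rw [mul_pow, Real.sq_sqrt (integral_nonneg fun x => sq_nonneg _),
        Real.sq_sqrt (integral_nonneg fun x => sq_nonneg _)]

section

variable {E : Type*} [NormedAddCommGroup E] [InnerProductSpace ℝ E] [FiniteDimensional ℝ E]
  [MeasurableSpace E] [BorelSpace E]

/-- Mean value inequality along the segment, with the gradient decaying like `(1+‖y‖)^{-M}`; the
inequality `1+‖η‖ ≤ (1+‖ζ‖)(1+‖y‖)` moves the decay from `y` to `η`. The factor `‖ζ‖` is what later
becomes a power of `ε`. -/
lemma SchwartzMap.exists_norm_sub_shift_le (f : SchwartzMap E ℂ) (M : ℕ) :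
    ∃ C : ℝ, 0 < C ∧ ∀ η ζ : E,
      ‖f (η - ζ) - f η‖ ≤ C * ‖ζ‖ * (1 + ‖ζ‖) ^ M * ((1 + ‖η‖) ^ M)⁻¹ := by
  set C : ℝ := 2 ^ M * (Finset.Iic (M, 1)).sup
    (fun m => SchwartzMap.seminorm ℝ m.1 m.2) f + 1 with hC
  have hC0 : 0 < C := by positivity
  have hbound : ∀ y : E, ‖fderiv ℝ f y‖ ≤ C * ((1 + ‖y‖) ^ M)⁻¹ := by
    intro y
    have := SchwartzMap.one_add_le_sup_seminorm_apply (𝕜 := ℝ) (m := (M, 1)) (k := M) (n := 1)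
      le_rfl le_rfl f y
    rw [norm_iteratedFDeriv_one] at this
    rw [← div_eq_mul_inv, le_div_iff₀ (by positivity), mul_comm]
    linarith
  refine ⟨C, hC0, fun η ζ => ?_⟩
  have hseg : ∀ y ∈ segment ℝ η (η - ζ),
      ‖fderiv ℝ f y‖ ≤ C * ((1 + ‖ζ‖) ^ M * ((1 + ‖η‖) ^ M)⁻¹) := by
    intro y hy
    refine (hbound y).trans ?_
    have hd : ‖η - y‖ ≤ ‖ζ‖ := by
      have := norm_sub_le_of_mem_segment hy
      rw [norm_sub_rev]
      simpa using this
    have h1 : 1 + ‖η‖ ≤ (1 + ‖ζ‖) * (1 + ‖y‖) := by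
      have : ‖η‖ ≤ ‖η - y‖ + ‖y‖ := by simpa using norm_add_le (η - y) y
      nlinarith [norm_nonneg ζ, norm_nonneg y]
    have h2 : (1 + ‖η‖) ^ M ≤ (1 + ‖ζ‖) ^ M * (1 + ‖y‖) ^ M := by
      rw [← mul_pow]; gcongr
    gcongr
    rw [← div_eq_mul_inv, inv_eq_one_div, div_le_div_iff₀ (by positivity) (by positivity)]
    linarith
  have := (convex_segment (𝕜 := ℝ) η (η - ζ)).norm_image_sub_le_of_norm_fderiv_le
    (f := (f : E → ℂ)) (𝕜 := ℝ) (fun y _ => f.differentiableAt) hseg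
    (left_mem_segment ℝ η (η - ζ)) (right_mem_segment ℝ η (η - ζ))
  refine this.trans (le_of_eq ?_)
  rw [sub_sub_cancel_left, norm_neg]
  ring

lemma norm_fourierChar_eq_one (t : ℝ) : ‖(𝐞 t : ℂ)‖ = 1 := Circle.norm_coe _

lemma norm_charSum_le_sum {ι : Type*} (s : Finset ι) (a : ι → ℝ) (x : ι → E) (η : E) :
    ‖charSum s a x η‖ ≤ ∑ i ∈ s, |a i| := by
  refine (norm_sum_le _ _).trans (Finset.sum_le_sum fun i _ => ?_)
  rw [norm_mul, norm_fourierChar_eq_one, mul_one, Complex.norm_real, Real.norm_eq_abs]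

/-- A compactly supported smooth function equal to `1` on the unit ball. -/
lemma exists_schwartzMap_eq_one_on_ball :
    ∃ f : SchwartzMap E ℂ, ∀ x : E, ‖x‖ ≤ 1 → f x = 1 := by
  let b : ContDiffBump (0 : E) := ⟨1, 2, one_pos, one_lt_two⟩
  have h1 : HasCompactSupport (fun x => ((b x : ℝ) : ℂ)) :=
    b.hasCompactSupport.comp_left (g := fun r : ℝ => (r : ℂ)) Complex.ofReal_zero
  have h2 : ContDiff ℝ (⊤ : ℕ∞) (fun x => ((b x : ℝ) : ℂ)) :=
    Complex.ofRealCLM.contDiff.comp b.contDiff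
  refine ⟨h1.toSchwartzMap h2, fun x hx => ?_⟩
  have : b x = 1 := b.one_of_mem_closedBall (by simpa using hx)
  simp [this]

/-- Fourier inversion for Schwartz functions. -/
lemma SchwartzMap.exists_eq_integral_fourierChar (f : SchwartzMap E ℂ) :
    ∃ g : SchwartzMap E ℂ, ∀ x : E, f x = ∫ η : E, (𝐞 ⟪x, η⟫ : ℂ) * g η := by
  refine ⟨(𝓕 f : SchwartzMap E ℂ), fun x => ?_⟩
  have h := congrArg (fun g : SchwartzMap E ℂ => g x)
    (FourierTransform.fourierInv_fourier_eq (F := SchwartzMap E ℂ) f)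
  simp only [SchwartzMap.fourierInv_coe, Real.fourierInv_eq] at h
  rw [← h]
  refine integral_congr_ae (Eventually.of_forall fun η => ?_)
  simp only [Circle.smul_def, smul_eq_mul, real_inner_comm]

lemma SchwartzMap.integrable_fourierChar_mul (f : SchwartzMap E ℂ) (x ζ : E) :
    Integrable fun η : E => (𝐞 ⟪x, η⟫ : ℂ) * f (η - ζ) := by
  refine (f.integrable.comp_sub_right ζ).bdd_mul (c := 1) ?_
    (Eventually.of_forall fun η => (norm_fourierChar_eq_one _).le)
  refine Continuous.aestronglyMeasurable ?_
  exact continuous_subtype_val.comp (Real.continuous_fourierChar.comp (by fun_prop))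

/-- The hypothesis on `g` says that its Fourier integral is `1` on the support. Modulating by `ζ`
reproduces each exponential as an integral against the translate of `g`. Mass zero permits
subtracting the same formula at frequency `0`, so only the difference of `g` and its translate
enters. -/
lemma charSum_eq_integral (g : SchwartzMap E ℂ)
    (hg : ∀ x : E, ‖x‖ ≤ 1 → 1 = ∫ η : E, (𝐞 ⟪x, η⟫ : ℂ) * g η)
    (s : Finset E) (a : E → ℝ) (x : E → E) (hx : ∀ i ∈ s, ‖x i‖ ≤ 1) (ha : ∑ i ∈ s, a i = 0)
    (ζ : E) :
    charSum s a x ζ = ∫ η : E, charSum s a x η * (g (η - ζ) - g η) := by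
  have h1 : ∀ i ∈ s, (𝐞 ⟪x i, ζ⟫ : ℂ) = ∫ η : E, (𝐞 ⟪x i, η⟫ : ℂ) * g (η - ζ) := by
    intro i hi
    rw [← integral_add_right_eq_self _ ζ]
    conv_lhs => rw [← mul_one (𝐞 ⟪x i, ζ⟫ : ℂ), hg _ (hx i hi)]
    rw [← integral_const_mul]
    refine integral_congr_ae (Eventually.of_forall fun η => ?_)
    simp only [add_sub_cancel_right, inner_add_right, AddChar.map_add_eq_mul, Circle.coe_mul]
    ring
  have h0 : ∀ i ∈ s, (1 : ℂ) = ∫ η : E, (𝐞 ⟪x i, η⟫ : ℂ) * g η := fun i hi =>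
    hg _ (hx i hi)
  have hint0 : ∀ i, Integrable fun η : E => (𝐞 ⟪x i, η⟫ : ℂ) * g η := fun i => by
    simpa using SchwartzMap.integrable_fourierChar_mul g (x i) 0
  have hint := fun i => SchwartzMap.integrable_fourierChar_mul g (x i) ζ
  have h3 : ∀ i ∈ s, (𝐞 ⟪x i, ζ⟫ : ℂ) - 1 =
      ∫ η : E, (𝐞 ⟪x i, η⟫ : ℂ) * (g (η - ζ) - g η) := by
    intro i hi
    simp only [mul_sub]
    rw [integral_sub (hint i) (hint0 i), ← h1 i hi, ← h0 i hi]
  have hint3 : ∀ i, Integrable fun η : E => (𝐞 ⟪x i, η⟫ : ℂ) * (g (η - ζ) - g η) := by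
    intro i
    simp only [mul_sub]
    exact (hint i).sub (hint0 i)
  calc charSum s a x ζ = ∑ i ∈ s, (a i : ℂ) * ((𝐞 ⟪x i, ζ⟫ : ℂ) - 1) := by
        simp only [mul_sub, mul_one, Finset.sum_sub_distrib, ← Complex.ofReal_sum, ha,
          Complex.ofReal_zero, sub_zero]
        rfl
    _ = ∑ i ∈ s, ∫ η : E, (a i : ℂ) * ((𝐞 ⟪x i, η⟫ : ℂ) * (g (η - ζ) - g η)) :=
        Finset.sum_congr rfl fun i hi => by rw [h3 i hi, integral_const_mul]
    _ = ∫ η : E, charSum s a x η * (g (η - ζ) - g η) := by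
        rw [← integral_finsetSum _ fun i _ => (hint3 i).const_mul _]
        refine integral_congr_ae (Eventually.of_forall fun η => ?_)
        simp only [charSum, Finset.sum_mul, mul_assoc]

variable (E) in
lemma integrable_sq_decay_mul (H : ℝ) (hH0 : 0 < H) (hH1 : H < 1) :
    Integrable (fun η : E => (((1 + ‖η‖) ^ (Module.finrank ℝ E + 2))⁻¹) ^ 2 *
      ‖η‖ ^ ((Module.finrank ℝ E : ℝ) + 2 * H)) := by
  set d := Module.finrank ℝ E
  have h := integrable_one_add_norm (E := E) (μ := volume) (r := d + 1)
    (by simp only [d]; linarith)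
  refine h.mono' (Measurable.aestronglyMeasurable (by fun_prop))
    (Eventually.of_forall fun η => ?_)
  have h1 : (0 : ℝ) < 1 + ‖η‖ := by positivity
  rw [Real.norm_of_nonneg (by positivity)]
  calc (((1 + ‖η‖) ^ (d + 2))⁻¹) ^ 2 * ‖η‖ ^ ((d : ℝ) + 2 * H)
      ≤ (((1 + ‖η‖) ^ (d + 2))⁻¹) ^ 2 * (1 + ‖η‖) ^ ((d : ℝ) + 2 * H) := by
        gcongr; linarith
    _ = (1 + ‖η‖) ^ (-((d : ℝ) + 4 - 2 * H)) := by
        rw [inv_pow, ← pow_mul, ← Real.rpow_natCast, ← Real.rpow_neg h1.le,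
          ← Real.rpow_add h1]
        congr 1; push_cast; ring
    _ ≤ (1 + ‖η‖) ^ (-((d : ℝ) + 1)) := by
        apply Real.rpow_le_rpow_of_exponent_le (by linarith [norm_nonneg η])
        linarith

variable (E) in
/-- On the unit ball, the characteristic sums of signed measures of total mass zero are bounded
by the standard deviation of the corresponding increments. -/
lemma exists_sq_norm_charSum_le [Nontrivial E] {H : ℝ} (hH0 : 0 < H) (hH1 : H < 1) :
    ∃ C : ℝ, 0 < C ∧ ∃ M : ℕ, ∀ (s : Finset E) (a : E → ℝ) (x : E → E), (∀ i ∈ s, ‖x i‖ ≤ 1) →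
      ∑ i ∈ s, a i = 0 → ∀ ζ : E, ‖charSum s a x ζ‖ ^ 2 ≤
        C * (‖ζ‖ * (1 + ‖ζ‖) ^ M) ^ 2 * variogramForm H s a x := by
  obtain ⟨f, hf⟩ := exists_schwartzMap_eq_one_on_ball (E := E)
  obtain ⟨g, hg⟩ := SchwartzMap.exists_eq_integral_fourierChar f
  set M := Module.finrank ℝ E + 2
  obtain ⟨K, hK, hKb⟩ := SchwartzMap.exists_norm_sub_shift_le g M
  obtain ⟨c, hc, hcE⟩ := exists_spectralIntegral_eq (E := E) hH0 hH1
  set p : ℝ := (Module.finrank ℝ E : ℝ) + 2 * H with hp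
  have hp0 : 0 < p := by positivity
  set J : ℝ := ∫ η : E, (((1 + ‖η‖) ^ M)⁻¹) ^ 2 * ‖η‖ ^ p
  have hJ0 : 0 ≤ J := integral_nonneg fun η => by positivity
  have hJint := integrable_sq_decay_mul E H hH0 hH1
  -- The factor `2c` comes from the spectral formula for the variance, `K` from the shift estimate
  -- and `J` from Cauchy-Schwarz; `J + 1` only ensures positivity.
  refine ⟨2 * c * K ^ 2 * (J + 1), by positivity, M, fun s a x hx ha ζ => ?_⟩
  have hV := variogramForm_nonneg hH0 hH1 s a x ha
  set F : E → ℝ := fun η => ‖charSum s a x η‖ * ‖η‖ ^ (-(p / 2)) with hF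
  set G : E → ℝ := fun η => ((1 + ‖η‖) ^ M)⁻¹ * ‖η‖ ^ (p / 2) with hG
  have hFm : AEStronglyMeasurable F := by
    refine Measurable.aestronglyMeasurable ?_
    have := (continuous_charSum s a x).measurable
    fun_prop
  have hGm : AEStronglyMeasurable G := Measurable.aestronglyMeasurable (by fun_prop)
  have hF2 : ∀ η, F η ^ 2 = ‖charSum s a x η‖ ^ 2 * spectralWeight E H η := by
    intro η
    simp only [hF, mul_pow, spectralWeight]
    rw [← Real.rpow_natCast (‖η‖ ^ (-(p / 2))), ← Real.rpow_mul (norm_nonneg _)]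
    congr 2; push_cast; ring
  have hG2 : ∀ η, G η ^ 2 = (((1 + ‖η‖) ^ M)⁻¹) ^ 2 * ‖η‖ ^ p := by
    intro η
    simp only [hG, mul_pow]
    rw [← Real.rpow_natCast (‖η‖ ^ (p / 2)), ← Real.rpow_mul (norm_nonneg _)]
    congr 2; push_cast; ring
  have hF2i : Integrable (fun η => F η ^ 2) := by
    simp only [hF2]; exact integrable_norm_sq_charSum_mul hH0 hH1 s a x ha
  have hG2i : Integrable (fun η => G η ^ 2) := by
    simp only [hG2]; exact hJint
  have hFG : ∀ᵐ η : E, ‖charSum s a x η * (g (η - ζ) - g η)‖ ≤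
      K * ‖ζ‖ * (1 + ‖ζ‖) ^ M * (F η * G η) := by
    -- The two powers of `‖η‖` cancel only off the origin: at `0` the real power with nonzero
    -- exponent is `0` by convention.
    have hne : ∀ᵐ η : E, η ≠ 0 := by
      simp [ae_iff]
    filter_upwards [hne] with η hη
    have hη0 : 0 < ‖η‖ := norm_pos_iff.2 hη
    have h1 : F η * G η = ‖charSum s a x η‖ * ((1 + ‖η‖) ^ M)⁻¹ := by
      simp only [hF, hG]
      have : ‖η‖ ^ (-(p / 2)) * ‖η‖ ^ (p / 2) = 1 := by
        rw [← Real.rpow_add hη0]; simp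
      linear_combination (‖charSum s a x η‖ * ((1 + ‖η‖) ^ M)⁻¹) * this
    rw [norm_mul, h1]
    calc _ ≤ ‖charSum s a x η‖ * (K * ‖ζ‖ * (1 + ‖ζ‖) ^ M * ((1 + ‖η‖) ^ M)⁻¹) := by
          gcongr; exact hKb η ζ
      _ = _ := by ring
  have hle : ‖charSum s a x ζ‖ ≤ K * ‖ζ‖ * (1 + ‖ζ‖) ^ M * ∫ η, F η * G η := by
    rw [charSum_eq_integral g (fun x hx => by rw [← hg, hf x hx]) s a x hx ha ζ, ← integral_const_mul]
    exact norm_integral_le_of_norm_le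
      ((integrable_mul_of_sq_integrable hFm hGm hF2i hG2i).const_mul _) hFG
  have hCS := sq_integral_mul_le hFm hGm (fun η => by positivity) (fun η => by positivity)
    hF2i hG2i
  simp only [hF2, hG2] at hCS
  rw [integral_norm_sq_charSum_mul hH0 hH1 hcE s a x ha] at hCS
  calc ‖charSum s a x ζ‖ ^ 2 ≤ (K * ‖ζ‖ * (1 + ‖ζ‖) ^ M * ∫ η, F η * G η) ^ 2 := by gcongr
    _ = (K * ‖ζ‖ * (1 + ‖ζ‖) ^ M) ^ 2 * (∫ η, F η * G η) ^ 2 := by ring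
    _ ≤ (K * ‖ζ‖ * (1 + ‖ζ‖) ^ M) ^ 2 * (2 * c * variogramForm H s a x * J) := by gcongr
    _ ≤ (K * ‖ζ‖ * (1 + ‖ζ‖) ^ M) ^ 2 * (2 * c * variogramForm H s a x * (J + 1)) := by
        gcongr; linarith
    _ = _ := by ring

variable (E) in
/-- On a ball of radius `ε`, the characteristic sums of signed measures of total mass zero are
`O(ε^{1-H})` times the standard deviation of the corresponding increments. -/
lemma exists_sq_norm_charSum_le_of_mem_ball [Nontrivial E] {H : ℝ} (hH0 : 0 < H) (hH1 : H < 1) :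
    ∃ C : ℝ, 0 < C ∧ ∃ M : ℕ, ∀ (p : E) (ε : ℝ), 0 < ε → ε ≤ 1 → ∀ (s : Finset E) (a : E → ℝ),
      (∀ i ∈ s, i ∈ Metric.ball p ε) → ∑ i ∈ s, a i = 0 → ∀ ζ : E, ‖charSum s a id ζ‖ ^ 2 ≤
        C * ε ^ (2 - 2 * H) * (‖ζ‖ * (1 + ‖ζ‖) ^ M) ^ 2 * variogramForm H s a id := by
  obtain ⟨C, hC, M, h⟩ := exists_sq_norm_charSum_le E hH0 hH1
  refine ⟨C, hC, M, fun p ε hε hε1 s a hs ha ζ => ?_⟩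
  have hV := variogramForm_nonneg hH0 hH1 s a id ha
  -- Recentring multiplies the characteristic sum by a phase; dilating to the unit ball replaces `ζ`
  -- by `ε • ζ` and divides the variance by `ε^{2H}`.
  set x : E → E := fun i => ε⁻¹ • (i - p) with hx
  have h1 : ‖charSum s a id ζ‖ = ‖charSum s a x (ε • ζ)‖ := by
    have : charSum s a id ζ = (𝐞 ⟪p, ζ⟫ : ℂ) * charSum s a x (ε • ζ) := by
      rw [charSum, charSum, Finset.mul_sum]
      refine Finset.sum_congr rfl fun i _ => ?_
      have : ⟪id i, ζ⟫ = ⟪p, ζ⟫ + ⟪x i, ε • ζ⟫ := by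
        simp only [hx, real_inner_smul_left, real_inner_smul_right, inner_sub_left, id]
        field_simp
        ring
      rw [this, AddChar.map_add_eq_mul, Circle.coe_mul]
      ring
    rw [this, norm_mul, norm_fourierChar_eq_one, one_mul]
  have h2 : variogramForm H s a x = (ε ^ (2 * H))⁻¹ * variogramForm H s a id := by
    rw [variogramForm, variogramForm, mul_left_comm]
    congr 1
    rw [Finset.mul_sum]
    refine Finset.sum_congr rfl fun i _ => ?_
    rw [Finset.mul_sum]
    refine Finset.sum_congr rfl fun j _ => ?_
    have : ‖x i - x j‖ = ε⁻¹ * ‖i - j‖ := by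
      simp only [hx]
      rw [← smul_sub, sub_sub_sub_cancel_right, norm_smul, Real.norm_of_nonneg (by positivity)]
    rw [this, Real.mul_rpow (by positivity) (norm_nonneg _), Real.inv_rpow hε.le]
    simp only [id]
    ring
  have h3 := h s a x (fun i hi => ?_) ha (ε • ζ)
  · rw [h1]
    refine h3.trans ?_
    rw [h2, norm_smul, Real.norm_of_nonneg hε.le]
    -- Here `ε²` is the square of the linear factor `‖ε • ζ‖`, and the other factor comes from
    -- rescaling the variance.
    have h4 : ε ^ (2 - 2 * H) = ε ^ 2 * (ε ^ (2 * H))⁻¹ := by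
      rw [Real.rpow_sub hε, div_eq_mul_inv, Real.rpow_two]
    calc C * (ε * ‖ζ‖ * (1 + ε * ‖ζ‖) ^ M) ^ 2 * ((ε ^ (2 * H))⁻¹ * variogramForm H s a id)
        ≤ C * (ε * ‖ζ‖ * (1 + 1 * ‖ζ‖) ^ M) ^ 2 *
          ((ε ^ (2 * H))⁻¹ * variogramForm H s a id) := by gcongr
      _ = _ := by rw [h4]; ring
  · have := hs i hi
    rw [Metric.mem_ball, dist_eq_norm] at this
    simp only [hx, norm_smul, norm_inv, Real.norm_of_nonneg hε.le]
    rw [inv_mul_le_iff₀ hε]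
    linarith

end

end LevyFBM

end

noncomputable section

set_option linter.unusedSectionVars false

namespace LevyFBM

open scoped RealInnerProductSpace FourierTransform

/-! ### The cross-correlation of increments over distant balls -/

section

variable {E : Type*} [NormedAddCommGroup E] [InnerProductSpace ℝ E] [FiniteDimensional ℝ E]
  [MeasurableSpace E] [BorelSpace E]

/-- Away from the origin, `|z|^{2H}` is locally the Fourier transform of a Schwartz function. -/
lemma exists_schwartzMap_norm_rpow_eq_integral (H : ℝ) {z₀ : E} (hz₀ : z₀ ≠ 0) :
    ∃ g : SchwartzMap E ℂ, ∀ z : E, ‖z - z₀‖ ≤ ‖z₀‖ / 2 →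
      ((‖z‖ ^ (2 * H) : ℝ) : ℂ) = ∫ η : E, (𝐞 ⟪z, η⟫ : ℂ) * g η := by
  have hr : 0 < ‖z₀‖ := norm_pos_iff.2 hz₀
  -- The outer radius is less than `‖z₀‖`, so the support avoids the origin, the only point where
  -- the power of the norm may fail to be smooth.
  let b : ContDiffBump z₀ := ⟨‖z₀‖ / 2, 3 * ‖z₀‖ / 4, by linarith, by linarith⟩
  have hb0 : ∀ z ∈ tsupport b, z ≠ 0 := by
    intro z hz h0
    rw [b.tsupport_eq, Metric.mem_closedBall, h0, dist_eq_norm, zero_sub, norm_neg] at hz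
    change ‖z₀‖ ≤ 3 * ‖z₀‖ / 4 at hz
    linarith
  have h1 : HasCompactSupport (fun z => ((b z * ‖z‖ ^ (2 * H) : ℝ) : ℂ)) :=
    (b.hasCompactSupport.mul_right (f' := fun z => ‖z‖ ^ (2 * H))).comp_left
      (g := fun r : ℝ => (r : ℂ)) Complex.ofReal_zero
  have h2 : ContDiff ℝ (⊤ : ℕ∞) (fun z => ((b z * ‖z‖ ^ (2 * H) : ℝ) : ℂ)) := by
    refine Complex.ofRealCLM.contDiff.comp ?_
    refine contDiff_iff_contDiffAt.2 fun z => ?_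
    by_cases hz' : z ∈ tsupport b
    swap
    · refine (contDiffAt_const (c := (0 : ℝ))).congr_of_eventuallyEq ?_
      filter_upwards [notMem_tsupport_iff_eventuallyEq.1 hz'] with y hy
      exact mul_eq_zero_of_left hy _
    have hz0 := hb0 z hz'
    exact b.contDiff.contDiffAt.mul
      ((contDiffAt_norm ℝ hz0).rpow_const_of_ne (norm_ne_zero_iff.2 hz0))
  obtain ⟨g, hg⟩ := SchwartzMap.exists_eq_integral_fourierChar (h1.toSchwartzMap h2)
  refine ⟨g, fun z hz => ?_⟩
  have hb : b z = 1 := b.one_of_mem_closedBall (by simpa [dist_eq_norm] using hz)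
  rw [← hg z]
  simp [hb]

/-- The finitely supported signed measures of total mass zero supported in `S`. -/
def massZero (S : Set E) : Submodule ℝ (E →₀ ℝ) :=
  Finsupp.supported ℝ ℝ S ⊓ LinearMap.ker (Finsupp.linearCombination ℝ fun _ : E => (1 : ℝ))

lemma mem_massZero {S : Set E} {a : E →₀ ℝ} :
    a ∈ massZero S ↔ (∀ u ∈ a.support, u ∈ S) ∧ ∑ u ∈ a.support, a u = 0 := by
  rw [massZero, Submodule.mem_inf, Finsupp.mem_supported, LinearMap.mem_ker,
    Finsupp.linearCombination_apply, Finsupp.sum]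
  simp only [smul_eq_mul, mul_one]
  rfl

/-- The characteristic function of a finitely supported signed measure, as a linear map. -/
def charLin (ζ : E) : (E →₀ ℝ) →ₗ[ℝ] ℂ :=
  Finsupp.linearCombination ℝ fun u : E => (𝐞 ⟪u, ζ⟫ : ℂ)

lemma charLin_eq_charSum (a : E →₀ ℝ) (ζ : E) : charLin ζ a = charSum a.support a id ζ := by
  rw [charLin, Finsupp.linearCombination_apply, Finsupp.sum, charSum]
  simp only [Complex.real_smul, id]

/-- `Φ` maps signed measures `a` of mass zero to vectors whose Gram matrix is given by the
variogram `|u - v|^{2H}`. -/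
def IsVariogramMap {F : Type*} [NormedAddCommGroup F] [InnerProductSpace ℝ F] (H : ℝ)
    (Φ : (E →₀ ℝ) →ₗ[ℝ] F) : Prop :=
  ∀ a ∈ massZero (Set.univ : Set E), ∀ b ∈ massZero (Set.univ : Set E),
    ⟪Φ a, Φ b⟫ = -(1 / 2) * ∑ i ∈ a.support, ∑ j ∈ b.support, a i * b j * ‖i - j‖ ^ (2 * H)

lemma massZero_mono {S T : Set E} (h : S ⊆ T) : massZero S ≤ massZero T :=
  inf_le_inf_right _ (Finsupp.supported_mono h)

lemma IsVariogramMap.norm_sq {F : Type*} [NormedAddCommGroup F] [InnerProductSpace ℝ F] {H : ℝ}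
    {Φ : (E →₀ ℝ) →ₗ[ℝ] F} (hΦ : IsVariogramMap H Φ) {S : Set E} {a : E →₀ ℝ}
    (ha : a ∈ massZero S) : ‖Φ a‖ ^ 2 = variogramForm H a.support a id := by
  have ha' := massZero_mono (Set.subset_univ S) ha
  rw [← real_inner_self_eq_norm_sq, hΦ a ha' a ha', variogramForm]
  rfl

lemma SchwartzMap.integrable_weight_mul_norm (g : SchwartzMap E ℂ) (M : ℕ) :
    Integrable fun ζ : E => (‖ζ‖ * (1 + ‖ζ‖) ^ M) ^ 2 * ‖g ζ‖ := by
  set k := (1 + M) * 2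
  have h1 := ((g.integrable_pow_mul volume 0).add
    (g.integrable_pow_mul volume k)).const_mul (2 ^ (k - 1))
  refine h1.mono' ?_ (Eventually.of_forall fun ζ => ?_)
  · have := g.continuous
    exact Continuous.aestronglyMeasurable (by fun_prop)
  · rw [Real.norm_of_nonneg (by positivity)]
    simp only [Pi.add_apply, pow_zero]
    have h2 := add_pow_le (zero_le_one' ℝ) (norm_nonneg ζ) k
    rw [one_pow] at h2
    calc (‖ζ‖ * (1 + ‖ζ‖) ^ M) ^ 2 * ‖g ζ‖ ≤ ((1 + ‖ζ‖) * (1 + ‖ζ‖) ^ M) ^ 2 * ‖g ζ‖ := by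
          gcongr; linarith
      _ = (1 + ‖ζ‖) ^ k * ‖g ζ‖ := by rw [← pow_succ', ← pow_mul, add_comm M 1]
      _ ≤ (2 ^ (k - 1) * (1 + ‖ζ‖ ^ k)) * ‖g ζ‖ := by gcongr
      _ = _ := by ring

/-- The exponential at `u - v` factors into one at `u` and a conjugate one at `v`. The covariance
thus decouples into a product of two characteristic functions, each of which can be estimated on its
own ball. -/
lemma inner_eq_integral_charSum {F : Type*} [NormedAddCommGroup F] [InnerProductSpace ℝ F]
    {H : ℝ} {Φ : (E →₀ ℝ) →ₗ[ℝ] F} (hΦ : IsVariogramMap H Φ) {S T : Set E}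
    (g : SchwartzMap E ℂ) (hg : ∀ u ∈ S, ∀ v ∈ T,
      ((‖u - v‖ ^ (2 * H) : ℝ) : ℂ) = ∫ η : E, (𝐞 ⟪u - v, η⟫ : ℂ) * g η)
    {a b : E →₀ ℝ} (ha : a ∈ massZero S) (hb : b ∈ massZero T) :
    ((⟪Φ a, Φ b⟫ : ℝ) : ℂ) =
      -(1 / 2) * ∫ η : E, charLin η a * (starRingEnd ℂ) (charLin η b) * g η := by
  have hint : ∀ u v : E, Integrable fun η : E => (𝐞 ⟪u - v, η⟫ : ℂ) * g η := fun u v => by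
    simpa using SchwartzMap.integrable_fourierChar_mul g (u - v) 0
  rw [hΦ a (massZero_mono (Set.subset_univ S) ha) b (massZero_mono (Set.subset_univ T) hb)]
  have h1 : ∀ η : E, charLin η a * (starRingEnd ℂ) (charLin η b) * g η =
      ∑ i ∈ a.support, ∑ j ∈ b.support, ((a i * b j : ℝ) : ℂ) * ((𝐞 ⟪i - j, η⟫ : ℂ) * g η) := by
    intro η
    rw [charLin_eq_charSum, charLin_eq_charSum, charSum, charSum, map_sum, Finset.sum_mul_sum,
      Finset.sum_mul]
    refine Finset.sum_congr rfl fun i _ => ?_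
    rw [Finset.sum_mul]
    refine Finset.sum_congr rfl fun j _ => ?_
    have : (𝐞 ⟪i - j, η⟫ : ℂ) = (𝐞 ⟪i, η⟫ : ℂ) * (starRingEnd ℂ) (𝐞 ⟪j, η⟫ : ℂ) := by
      rw [inner_sub_left, sub_eq_add_neg, AddChar.map_add_eq_mul, Circle.coe_mul,
        AddChar.map_neg_eq_inv, Circle.coe_inv_eq_conj]
    rw [this, map_mul, Complex.conj_ofReal]
    simp only [id]
    push_cast
    ring
  simp only [h1]
  rw [integral_finsetSum _ fun i _ => integrable_finsetSum _ fun j _ => (hint i j).const_mul _]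
  push_cast
  congr 1
  refine Finset.sum_congr rfl fun i hi => ?_
  rw [integral_finsetSum _ fun j _ => (hint i j).const_mul _]
  refine Finset.sum_congr rfl fun j hj => ?_
  rw [integral_const_mul, ← hg i ((mem_massZero.1 ha).1 i hi) j ((mem_massZero.1 hb).1 j hj)]

/-- Bessel's inequality for a complex-valued functional bounded by the norm. -/
lemma sum_sq_norm_le_of_bounded {V F κ : Type*} [AddCommGroup V] [Module ℝ V]
    [NormedAddCommGroup F] [InnerProductSpace ℝ F] [Fintype κ] (Φ : V →ₗ[ℝ] F) (L : V →ₗ[ℝ] ℂ)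
    (Z : Submodule ℝ V) {B K : ℝ} (hB : 0 ≤ B) (hK0 : 0 ≤ K) (hL : ∀ a ∈ Z, ‖L a‖ ^ 2 ≤ B * ‖Φ a‖ ^ 2)
    (a : κ → V) (haZ : ∀ k, a k ∈ Z)
    (hK : ∀ c : κ → ℝ, ‖∑ k, c k • Φ (a k)‖ ^ 2 ≤ K * ∑ k, c k ^ 2) :
    ∑ k, ‖L (a k)‖ ^ 2 ≤ 2 * (B * K) := by
  have hlin : ∀ c : κ → ℝ, ‖∑ k, (c k : ℂ) * L (a k)‖ ^ 2 ≤ B * K * ∑ k, c k ^ 2 := by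
    intro c
    have h1 := hL (∑ k, c k • a k) (Z.sum_mem fun k _ => Z.smul_mem _ (haZ k))
    simp only [map_sum, map_smul, Complex.real_smul] at h1
    exact h1.trans (by rw [mul_assoc]; exact mul_le_mul_of_nonneg_left (hK c) hB)
  -- Self-improvement: with `c k` the real (or imaginary) part of `L (a k)`, the sum of squares is
  -- bounded by the norm of the sum, whose square is at most `B * K` times the same sum of squares.
  -- The two parts together give the factor `2`.
  have key : ∀ c : κ → ℝ, ∑ k, c k ^ 2 ≤ ‖∑ k, (c k : ℂ) * L (a k)‖ →
      ∑ k, c k ^ 2 ≤ B * K := by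
    intro c hc
    have h0 : 0 ≤ ∑ k, c k ^ 2 := Finset.sum_nonneg fun k _ => sq_nonneg _
    have h1 := hlin c
    have h2 : (∑ k, c k ^ 2) ^ 2 ≤ B * K * ∑ k, c k ^ 2 := (by gcongr : _ ≤ _).trans h1
    rcases h0.eq_or_lt with h | h
    · rw [← h]; positivity
    · nlinarith
  have hre : ∑ k, (L (a k)).re ^ 2 ≤ B * K := by
    refine key _ ?_
    refine le_trans (le_of_eq ?_) (Complex.re_le_norm _)
    rw [Complex.re_sum]
    exact Finset.sum_congr rfl fun k _ => by rw [Complex.re_ofReal_mul, sq]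
  have him : ∑ k, (L (a k)).im ^ 2 ≤ B * K := by
    refine key _ ?_
    refine le_trans (le_of_eq ?_) ((le_abs_self _).trans (Complex.abs_im_le_norm _))
    rw [Complex.im_sum]
    exact Finset.sum_congr rfl fun k _ => by rw [Complex.im_ofReal_mul, sq]
  have : ∀ k, ‖L (a k)‖ ^ 2 = (L (a k)).re ^ 2 + (L (a k)).im ^ 2 := fun k => by
    rw [← Complex.normSq_eq_norm_sq, Complex.normSq_apply]; ring
  simp only [this, Finset.sum_add_distrib]
  linarith

end

end LevyFBM

end

noncomputable section

set_option linter.unusedSectionVars false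

namespace LevyFBM

open scoped RealInnerProductSpace FourierTransform

/-! ### Hilbert-Schmidt bound for the cross-correlation -/

section

variable {E : Type*} [NormedAddCommGroup E] [InnerProductSpace ℝ E] [FiniteDimensional ℝ E]
  [MeasurableSpace E] [BorelSpace E]

lemma continuous_charLin (a : E →₀ ℝ) : Continuous fun ζ : E => charLin ζ a := by
  simp only [charLin_eq_charSum]
  exact continuous_charSum _ _ _

lemma integrable_norm_sq_charLin_mul (a : E →₀ ℝ) (g : SchwartzMap E ℂ) :
    Integrable fun ζ : E => ‖charLin ζ a‖ ^ 2 * ‖g ζ‖ := by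
  refine g.integrable.norm.bdd_mul (c := (∑ u ∈ a.support, |a u|) ^ 2) ?_
    (Eventually.of_forall fun ζ => ?_)
  · exact ((continuous_charLin a).norm.pow 2).aestronglyMeasurable
  · rw [norm_pow, norm_norm, charLin_eq_charSum]
    gcongr
    exact norm_charSum_le_sum _ _ _ _

/-- Hilbert-Schmidt bound for the cross-correlation between the increments in two small balls, for
families of finite linear combinations of increments. -/
lemma exists_sum_sq_inner_le_of_massZero {F : Type*} [NormedAddCommGroup F]
    [InnerProductSpace ℝ F] {H : ℝ} (hH0 : 0 < H) (hH1 : H < 1) {Φ : (E →₀ ℝ) →ₗ[ℝ] F}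
    (hΦ : IsVariogramMap H Φ) {s₁ s₂ : E} (hs : s₁ ≠ s₂) :
    ∃ C : ℝ, 0 < C ∧ ∃ ε₀ : ℝ, 0 < ε₀ ∧ ∀ ε : ℝ, 0 < ε → ε < ε₀ → ∀ (N : ℕ) (a b : Fin N → E →₀ ℝ),
      (∀ k, a k ∈ massZero (Metric.ball s₁ ε)) → (∀ k, b k ∈ massZero (Metric.ball s₂ ε)) →
      ∀ K D : ℝ, 0 ≤ K → 0 ≤ D → (∀ c : Fin N → ℝ, ‖∑ k, c k • Φ (a k)‖ ^ 2 ≤ K * ∑ k, c k ^ 2) →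
      (∀ k, ‖Φ (b k)‖ ^ 2 ≤ D) →
      ∑ k, ⟪Φ (a k), Φ (b k)⟫ ^ 2 ≤ C * (ε ^ (2 - 2 * H)) ^ 2 * K * D := by
  have hz : s₁ - s₂ ≠ 0 := sub_ne_zero.2 hs
  have : Nontrivial E := ⟨s₁, s₂, hs⟩
  have hr : 0 < ‖s₁ - s₂‖ := norm_pos_iff.2 hz
  obtain ⟨g, hg⟩ := exists_schwartzMap_norm_rpow_eq_integral H hz
  obtain ⟨C, hC, M, hCM⟩ := exists_sq_norm_charSum_le_of_mem_ball E hH0 hH1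
  set w : E → ℝ := fun ζ => ‖ζ‖ * (1 + ‖ζ‖) ^ M with hw
  have hw0 : ∀ ζ, 0 ≤ w ζ := fun ζ => by positivity
  set J : ℝ := ∫ ζ : E, w ζ ^ 2 * ‖g ζ‖ with hJ
  have hJint : Integrable fun ζ : E => w ζ ^ 2 * ‖g ζ‖ :=
    SchwartzMap.integrable_weight_mul_norm g M
  have hJ0 : 0 ≤ J := integral_nonneg fun ζ => by positivity
  -- With `ε` below a quarter of the distance, all differences `u - v` stay within half the distance
  -- of `s₁ - s₂`, where `g` represents the variogram; `ε ≤ 1` is needed for the small-ball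
  -- estimate.
  refine ⟨C ^ 2 * J ^ 2 + 1, by positivity, min 1 (‖s₁ - s₂‖ / 4), lt_min one_pos (by linarith),
    fun ε hε hε0 N a b ha hb K D hK0 hD0 hK hD => ?_⟩
  have hε1 : ε ≤ 1 := hε0.le.trans (min_le_left _ _)
  have hεr : ε < ‖s₁ - s₂‖ / 4 := hε0.trans_le (min_le_right _ _)
  set e : ℝ := ε ^ (2 - 2 * H) with he
  have he0 : 0 < e := Real.rpow_pos_of_pos hε _
  have hgST : ∀ u ∈ Metric.ball s₁ ε, ∀ v ∈ Metric.ball s₂ ε,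
      ((‖u - v‖ ^ (2 * H) : ℝ) : ℂ) = ∫ η : E, (𝐞 ⟪u - v, η⟫ : ℂ) * g η := by
    intro u hu v hv
    refine hg _ ?_
    rw [Metric.mem_ball, dist_eq_norm] at hu hv
    rw [sub_sub_sub_comm]
    exact (norm_sub_le _ _).trans (by linarith)
  have hbound : ∀ (p : E) (a : E →₀ ℝ), a ∈ massZero (Metric.ball p ε) → ∀ ζ : E,
      ‖charLin ζ a‖ ^ 2 ≤ C * e * w ζ ^ 2 * ‖Φ a‖ ^ 2 := by
    intro p a ha ζ
    rw [charLin_eq_charSum, hΦ.norm_sq ha]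
    obtain ⟨h1, h2⟩ := mem_massZero.1 ha
    exact hCM p ε hε hε1 a.support a h1 h2 ζ
  have hone : ∀ k, ⟪Φ (a k), Φ (b k)⟫ ^ 2 ≤
      1 / 4 * (C * e * D) * J * ∫ ζ : E, ‖charLin ζ (a k)‖ ^ 2 * ‖g ζ‖ := by
    intro k
    set B : ℝ := √(C * e * ‖Φ (b k)‖ ^ 2) with hB
    have hB0 : 0 ≤ B := Real.sqrt_nonneg _
    have hB2 : B ^ 2 = C * e * ‖Φ (b k)‖ ^ 2 := Real.sq_sqrt (by positivity)
    have hbk : ∀ ζ : E, ‖charLin ζ (b k)‖ ≤ B * w ζ := by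
      intro ζ
      refine le_of_sq_le_sq ?_ (by have := hw0 ζ; positivity)
      rw [mul_pow, hB2]
      refine (hbound s₂ (b k) (hb k) ζ).trans (le_of_eq (by ring))
    -- Splitting `‖g‖` evenly between the two factors keeps the characteristic sum of `a k` squared
    -- under the integral, ready for summation over `k`.
    set f1 : E → ℝ := fun ζ => ‖charLin ζ (a k)‖ * √‖g ζ‖ with hf1
    set f2 : E → ℝ := fun ζ => w ζ * √‖g ζ‖ with hf2
    have hf1sq : ∀ ζ, f1 ζ ^ 2 = ‖charLin ζ (a k)‖ ^ 2 * ‖g ζ‖ := fun ζ => by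
      simp only [hf1, mul_pow]; rw [Real.sq_sqrt (norm_nonneg _)]
    have hf2sq : ∀ ζ, f2 ζ ^ 2 = w ζ ^ 2 * ‖g ζ‖ := fun ζ => by
      simp only [hf2, mul_pow]; rw [Real.sq_sqrt (norm_nonneg _)]
    have hf1m : AEStronglyMeasurable f1 := by
      have := continuous_charLin (a k)
      have := g.continuous
      exact Continuous.aestronglyMeasurable (by fun_prop)
    have hf2m : AEStronglyMeasurable f2 := by
      have := g.continuous
      exact Continuous.aestronglyMeasurable (by fun_prop)
    have hi1 : Integrable fun ζ => f1 ζ ^ 2 := by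
      simp only [hf1sq]; exact integrable_norm_sq_charLin_mul (a k) g
    have hi2 : Integrable fun ζ => f2 ζ ^ 2 := by
      simp only [hf2sq]; exact hJint
    have hCS := sq_integral_mul_le hf1m hf2m (fun ζ => by positivity)
      (fun ζ => by have := hw0 ζ; positivity) hi1 hi2
    have hle : |⟪Φ (a k), Φ (b k)⟫| ≤ 1 / 2 * (B * ∫ ζ, f1 ζ * f2 ζ) := by
      rw [← Real.norm_eq_abs, ← Complex.norm_real,
        inner_eq_integral_charSum hΦ g hgST (ha k) (hb k), norm_mul, ← integral_const_mul]
      have : ‖(-(1 / 2) : ℂ)‖ = 1 / 2 := by simp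
      rw [this]
      gcongr
      refine norm_integral_le_of_norm_le
        ((integrable_mul_of_sq_integrable hf1m hf2m hi1 hi2).const_mul _)
        (Eventually.of_forall fun ζ => ?_)
      rw [norm_mul, norm_mul, RCLike.norm_conj]
      calc ‖charLin ζ (a k)‖ * ‖charLin ζ (b k)‖ * ‖g ζ‖
          ≤ ‖charLin ζ (a k)‖ * (B * w ζ) * ‖g ζ‖ := by gcongr; exact hbk ζ
        _ = B * (f1 ζ * f2 ζ) := by
          simp only [hf1, hf2]
          linear_combination -(‖charLin ζ (a k)‖ * (B * w ζ)) * Real.mul_self_sqrt (norm_nonneg (g ζ))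
    have hint0 : 0 ≤ ∫ ζ, f1 ζ ^ 2 := integral_nonneg fun ζ => sq_nonneg _
    calc ⟪Φ (a k), Φ (b k)⟫ ^ 2 = |⟪Φ (a k), Φ (b k)⟫| ^ 2 := (sq_abs _).symm
      _ ≤ (1 / 2 * (B * ∫ ζ, f1 ζ * f2 ζ)) ^ 2 := by gcongr
      _ = 1 / 4 * B ^ 2 * (∫ ζ, f1 ζ * f2 ζ) ^ 2 := by ring
      _ ≤ 1 / 4 * B ^ 2 * ((∫ ζ, f1 ζ ^ 2) * ∫ ζ, f2 ζ ^ 2) := by gcongr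
      _ = 1 / 4 * (C * e * ‖Φ (b k)‖ ^ 2) * J * ∫ ζ, f1 ζ ^ 2 := by
          simp only [hB2, hf2sq]; ring
      _ ≤ 1 / 4 * (C * e * D) * J * ∫ ζ, f1 ζ ^ 2 := by
          gcongr; exact hD k
      _ = _ := by simp only [hf1sq]
  -- Bessel is applied at each frequency before integrating, so summing over `k` costs no factor
  -- `N`.
  have hbessel : ∀ ζ : E, ∑ k, ‖charLin ζ (a k)‖ ^ 2 ≤ 2 * (C * e * w ζ ^ 2 * K) := fun ζ =>
    sum_sq_norm_le_of_bounded Φ (charLin ζ) (massZero (Metric.ball s₁ ε)) (by positivity) hK0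
      (fun a ha => hbound s₁ a ha ζ) a ha hK
  have hsum : ∑ k, ∫ ζ : E, ‖charLin ζ (a k)‖ ^ 2 * ‖g ζ‖ ≤ 2 * (C * e * K) * J := by
    rw [← integral_finsetSum _ fun k _ => integrable_norm_sq_charLin_mul (a k) g, hJ,
      ← integral_const_mul]
    refine integral_mono (integrable_finsetSum _ fun k _ => integrable_norm_sq_charLin_mul (a k) g)
      (hJint.const_mul _) fun ζ => ?_
    simp only
    rw [← Finset.sum_mul, ← mul_assoc]
    refine mul_le_mul_of_nonneg_right ((hbessel ζ).trans (le_of_eq (by ring))) (norm_nonneg _)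
  calc ∑ k, ⟪Φ (a k), Φ (b k)⟫ ^ 2
      ≤ ∑ k, 1 / 4 * (C * e * D) * J * ∫ ζ : E, ‖charLin ζ (a k)‖ ^ 2 * ‖g ζ‖ :=
        Finset.sum_le_sum fun k _ => hone k
    _ = 1 / 4 * (C * e * D) * J * ∑ k, ∫ ζ : E, ‖charLin ζ (a k)‖ ^ 2 * ‖g ζ‖ := by
        rw [Finset.mul_sum]
    _ ≤ 1 / 4 * (C * e * D) * J * (2 * (C * e * K) * J) := by gcongr
    _ = (1 / 2) * (C ^ 2 * J ^ 2) * (e ^ 2 * K * D) := by ring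
    _ ≤ (C ^ 2 * J ^ 2 + 1) * (e ^ 2 * K * D) := by
        gcongr
        nlinarith [mul_nonneg (sq_nonneg C) (sq_nonneg J)]
    _ = _ := by ring

/-- Hilbert-Schmidt bound for the cross-correlation between the closed spans of the increments in
two small balls. -/
lemma exists_sum_sq_inner_le {F : Type*} [NormedAddCommGroup F]
    [InnerProductSpace ℝ F] {H : ℝ} (hH0 : 0 < H) (hH1 : H < 1) {Φ : (E →₀ ℝ) →ₗ[ℝ] F}
    (hΦ : IsVariogramMap H Φ) {s₁ s₂ : E} (hs : s₁ ≠ s₂) :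
    ∃ C : ℝ, 0 < C ∧ ∃ ε₀ : ℝ, 0 < ε₀ ∧ ∀ ε : ℝ, 0 < ε → ε < ε₀ → ∀ (N : ℕ) (U V : Fin N → F),
      (∀ k, U k ∈ ((massZero (Metric.ball s₁ ε)).map Φ).topologicalClosure) →
      (∀ k, V k ∈ ((massZero (Metric.ball s₂ ε)).map Φ).topologicalClosure) →
      Orthonormal ℝ U → (∀ k, ‖V k‖ ≤ 1) →
      ∑ k, ⟪U k, V k⟫ ^ 2 ≤ C * (ε ^ (2 - 2 * H)) ^ 2 := by
  obtain ⟨C, hC, ε₀, hε₀, h⟩ := exists_sum_sq_inner_le_of_massZero hH0 hH1 hΦ hs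
  refine ⟨C, hC, ε₀, hε₀, fun ε hε hε1 N U V hU hV hUo hV1 => ?_⟩
  have hseq : ∀ (S : Set E) (W : F), W ∈ ((massZero S).map Φ).topologicalClosure →
      ∃ a : ℕ → E →₀ ℝ, (∀ m, a m ∈ massZero S) ∧ Tendsto (fun m => Φ (a m)) atTop (𝓝 W) := by
    intro S W hW
    obtain ⟨y, hy, hyW⟩ := mem_closure_iff_seq_limit.1 hW
    choose a ha hay using hy
    exact ⟨a, ha, by simpa only [hay] using hyW⟩
  choose a ha haU using fun k => hseq _ _ (hU k)
  choose b hb hbV using fun k => hseq _ _ (hV k)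
  -- The approximants of an orthonormal family are only nearly orthonormal; `(1 + δ)²` and `D` are
  -- the resulting values of `K` and of the norm bound, both tending to `1`.
  set δ : ℕ → ℝ := fun m => ∑ k, ‖Φ (a k m) - U k‖ with hδ
  have hδ0 : Tendsto δ atTop (𝓝 0) := by
    have : Tendsto δ atTop (𝓝 (∑ k : Fin N, ‖U k - U k‖)) :=
      tendsto_finsetSum _ fun k _ => ((haU k).sub_const _).norm
    simpa using this
  set D : ℕ → ℝ := fun m => (1 + ∑ k, ‖Φ (b k m) - V k‖) ^ 2 with hD
  have hD1 : Tendsto D atTop (𝓝 1) := by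
    have : Tendsto D atTop (𝓝 ((1 + ∑ k : Fin N, ‖V k - V k‖) ^ 2)) :=
      (tendsto_const_nhds.add (tendsto_finsetSum _ fun k _ => ((hbV k).sub_const _).norm)).pow 2
    simpa using this
  have hm : ∀ m, ∑ k, ⟪Φ (a k m), Φ (b k m)⟫ ^ 2 ≤
      C * (ε ^ (2 - 2 * H)) ^ 2 * (1 + δ m) ^ 2 * D m := by
    intro m
    refine h ε hε hε1 N (fun k => a k m) (fun k => b k m) (fun k => ha k m) (fun k => hb k m)
      _ _ (sq_nonneg _) (sq_nonneg _) (fun c => ?_) fun k => ?_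
    · have h1 : ‖∑ k, c k • U k‖ ^ 2 = ∑ k, c k ^ 2 := by
        rw [← real_inner_self_eq_norm_sq, hUo.inner_sum]
        simp [sq]
      have h2 : ‖∑ k, c k • U k‖ = √(∑ k, c k ^ 2) := by
        rw [← h1, Real.sqrt_sq (norm_nonneg _)]
      have h3 : ‖∑ k, c k • (Φ (a k m) - U k)‖ ≤ √(∑ k, c k ^ 2) * δ m := by
        refine (norm_sum_le _ _).trans ?_
        rw [hδ, Finset.mul_sum]
        refine Finset.sum_le_sum fun k _ => ?_
        rw [norm_smul]
        gcongr
        refine Real.le_sqrt_of_sq_le ?_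
        rw [Real.norm_eq_abs, sq_abs]
        exact Finset.single_le_sum (f := fun k => c k ^ 2) (fun k _ => sq_nonneg _)
          (Finset.mem_univ k)
      have h4 : ∑ k, c k • Φ (a k m) = ∑ k, c k • U k + ∑ k, c k • (Φ (a k m) - U k) := by
        rw [← Finset.sum_add_distrib]
        exact Finset.sum_congr rfl fun k _ => by rw [smul_sub]; abel
      have h5 : ‖∑ k, c k • Φ (a k m)‖ ≤ (1 + δ m) * √(∑ k, c k ^ 2) := by
        rw [h4]
        refine (norm_add_le _ _).trans ?_
        rw [h2]
        linarith
      calc _ ≤ ((1 + δ m) * √(∑ k, c k ^ 2)) ^ 2 := by gcongr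
        _ = _ := by rw [mul_pow, Real.sq_sqrt (Finset.sum_nonneg fun k _ => sq_nonneg _)]
    · have h1 : ‖Φ (b k m) - V k‖ ≤ ∑ k, ‖Φ (b k m) - V k‖ :=
        Finset.single_le_sum (f := fun k => ‖Φ (b k m) - V k‖) (fun k _ => norm_nonneg _)
          (Finset.mem_univ k)
      have h2 : ‖Φ (b k m)‖ ≤ ‖Φ (b k m) - V k‖ + ‖V k‖ := by
        simpa using norm_add_le (Φ (b k m) - V k) (V k)
      simp only [hD]
      gcongr
      linarith [hV1 k]
  have hl : Tendsto (fun m => ∑ k, ⟪Φ (a k m), Φ (b k m)⟫ ^ 2) atTop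
      (𝓝 (∑ k, ⟪U k, V k⟫ ^ 2)) :=
    tendsto_finsetSum _ fun k _ => ((haU k).inner (hbV k)).pow 2
  have hr : Tendsto (fun m => C * (ε ^ (2 - 2 * H)) ^ 2 * (1 + δ m) ^ 2 * D m) atTop
      (𝓝 (C * (ε ^ (2 - 2 * H)) ^ 2 * (1 + 0) ^ 2 * 1)) :=
    (((tendsto_const_nhds.add hδ0).pow 2).const_mul _).mul hD1
  have := le_of_tendsto_of_tendsto' hl hr hm
  simpa using this

end

end LevyFBM

end

noncomputable section

set_option linter.unusedSectionVars false

namespace LevyFBM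

open scoped RealInnerProductSpace ENNReal NNReal

/-! ### The chi-square divergence of correlated Gaussian vectors -/

lemma sq_setLIntegral_le {α : Type*} [MeasurableSpace α] {μ : Measure α} {D : α → ℝ≥0∞}
    (hD : Measurable D) (s : Set α) :
    (∫⁻ x in s, D x ∂μ) ^ 2 ≤ μ s * ∫⁻ x in s, D x ^ 2 ∂μ := by
  have h := ENNReal.lintegral_mul_le_Lp_mul_Lq (μ.restrict s) Real.HolderConjugate.two_two
    (f := 1) (g := D) aemeasurable_const hD.aemeasurable
  simp only [one_mul, Pi.one_apply, lintegral_const,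
    Measure.restrict_apply_univ, ENNReal.rpow_two, one_pow] at h
  calc (∫⁻ x in s, D x ∂μ) ^ 2
      ≤ (μ s ^ (1 / 2 : ℝ) * (∫⁻ x in s, D x ^ 2 ∂μ) ^ (1 / 2 : ℝ)) ^ 2 := by
        gcongr
    _ = _ := by
      rw [mul_pow, ← ENNReal.rpow_natCast, ← ENNReal.rpow_natCast, ← ENNReal.rpow_mul,
        ← ENNReal.rpow_mul]
      norm_num

/-- The discretized chi-square divergence of a measure `θ` with square integrable density with
respect to a product measure is bounded by the second moment of the density. -/
lemma sum_sq_div_le_of_withDensity {S T ι κ : Type*} [MeasurableSpace S] [MeasurableSpace T]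
    [Fintype ι] [Fintype κ] {ρ : Measure S} {γ : Measure T} [IsProbabilityMeasure ρ]
    [IsProbabilityMeasure γ] {D : S × T → ℝ≥0∞} (hD : Measurable D) {M : ℝ} (hM0 : 0 ≤ M)
    (hM : ∫⁻ p, D p ^ 2 ∂(ρ.prod γ) ≤ ENNReal.ofReal M)
    {C : κ → Set S} {G : ι → Set T} (hC : ∀ k, MeasurableSet (C k)) (hG : ∀ j, MeasurableSet (G j))
    (hCd : Pairwise fun i j => Disjoint (C i) (C j))
    (hGd : Pairwise fun i j => Disjoint (G i) (G j)) :
    ∑ j, ∑ k, (((ρ.prod γ).withDensity D).real (C k ×ˢ G j)) ^ 2 /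
      (γ.real (G j) * ρ.real (C k)) ≤ M := by
  set R : ι → κ → ℝ≥0∞ := fun j k => ∫⁻ p in C k ×ˢ G j, D p ^ 2 ∂(ρ.prod γ) with hR
  have hsum : ∑ j, ∑ k, R j k ≤ ENNReal.ofReal M := by
    refine le_trans ?_ hM
    have h1 : ∑ j, ∑ k, R j k = ∑ q : ι × κ, ∫⁻ p in C q.2 ×ˢ G q.1, D p ^ 2 ∂(ρ.prod γ) := by
      rw [Fintype.sum_prod_type]
    rw [h1, ← tsum_fintype (L := .unconditional _), ← lintegral_iUnion]
    · exact setLIntegral_le_lintegral _ _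
    · exact fun q => (hC q.2).prod (hG q.1)
    · intro q r hqr
      rw [Function.onFun, Set.disjoint_prod]
      by_cases h : q.2 = r.2
      · right
        exact hGd fun h' => hqr (Prod.ext h' h)
      · left
        exact hCd h
  have hRfin : ∀ j k, R j k ≠ ∞ := fun j k => by
    refine ne_top_of_le_ne_top ENNReal.ofReal_ne_top (le_trans ?_ hM)
    exact setLIntegral_le_lintegral _ _
  have hone : ∀ j k, (((ρ.prod γ).withDensity D).real (C k ×ˢ G j)) ^ 2 /
      (γ.real (G j) * ρ.real (C k)) ≤ (R j k).toReal := by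
    intro j k
    -- Cauchy-Schwarz on one cell bounds its contribution by the integral of `D²` over that cell;
    -- the cells are disjoint.
    have h1 := sq_setLIntegral_le (μ := ρ.prod γ) hD (C k ×ˢ G j)
    rw [← withDensity_apply _ ((hC k).prod (hG j)), Measure.prod_prod] at h1
    have h2 : ρ (C k) * γ (G j) * R j k ≠ ∞ :=
      ENNReal.mul_ne_top (ENNReal.mul_ne_top (measure_ne_top _ _) (measure_ne_top _ _)) (hRfin j k)
    have h3 := ENNReal.toReal_mono h2 h1
    rw [ENNReal.toReal_pow, ENNReal.toReal_mul, ENNReal.toReal_mul] at h3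
    refine div_le_of_le_mul₀ (by positivity) (by positivity) (h3.trans (le_of_eq ?_))
    simp only [Measure.real]
    ring
  calc _ ≤ ∑ j, ∑ k, (R j k).toReal :=
        Finset.sum_le_sum fun j _ => Finset.sum_le_sum fun k _ => hone j k
    _ = (∑ j, ∑ k, R j k).toReal := by
        rw [ENNReal.toReal_sum fun j _ => (ENNReal.sum_lt_top.2 fun k _ =>
          (hRfin j k).lt_top).ne]
        exact Finset.sum_congr rfl fun j _ => (ENNReal.toReal_sum fun k _ => hRfin j k).symm
    _ ≤ M := ENNReal.toReal_le_of_le_ofReal hM0 hsum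

/-- Tonelli's theorem for products of nonnegative integrable functions. -/
lemma lintegral_fintype_prod_ofReal {ι : Type*} [Fintype ι] {μ : ι → Measure ℝ}
    [∀ i, SigmaFinite (μ i)] {f : ι → ℝ → ℝ} (hf0 : ∀ i x, 0 ≤ f i x)
    (hf : ∀ i, Integrable (f i) (μ i)) :
    ∫⁻ x, ENNReal.ofReal (∏ i, f i (x i)) ∂(Measure.pi μ) =
      ∏ i, ENNReal.ofReal (∫ x, f i x ∂(μ i)) := by
  rw [← ofReal_integral_eq_lintegral_ofReal (Integrable.fintype_prod_dep hf)
    (Eventually.of_forall fun x => Finset.prod_nonneg fun i _ => hf0 i _),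
    integral_fintype_prod_eq_prod, ENNReal.ofReal_prod_of_nonneg fun i _ =>
      integral_nonneg (hf0 i)]

/-! ### The Gaussian likelihood ratio and its second moment -/

lemma integrable_exp_neg_mul_sub_sq {a : ℝ} (ha : 0 < a) (c : ℝ) :
    Integrable fun x : ℝ => Real.exp (-a * (x - c) ^ 2) :=
  (integrable_exp_neg_mul_sq ha).comp_sub_right c

lemma integral_exp_neg_mul_sub_sq (a c : ℝ) :
    ∫ x : ℝ, Real.exp (-a * (x - c) ^ 2) = √(Real.pi / a) := by
  rw [integral_sub_right_eq_self (fun x : ℝ => Real.exp (-a * x ^ 2)) c, integral_gaussian]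

/-- Density of `N(z, 1 - v)` with respect to `N(0, 1)`. -/
def gaussLik (v x z : ℝ) : ℝ :=
  (√(1 - v))⁻¹ * Real.exp (x ^ 2 / 2 - (x - z) ^ 2 / (2 * (1 - v)))

lemma gaussLik_nonneg (v x z : ℝ) : 0 ≤ gaussLik v x z := by unfold gaussLik; positivity

lemma gaussLik_mul_gaussianPDFReal {v : ℝ} (hv : v < 1) (x z : ℝ) :
    gaussianPDFReal 0 1 x * gaussLik v x z = gaussianPDFReal z (1 - v).toNNReal x := by
  have h1 : 0 < 1 - v := by linarith
  rw [gaussianPDFReal, gaussianPDFReal, gaussLik, Real.coe_toNNReal _ h1.le, NNReal.coe_one,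
    Real.sqrt_mul (by positivity) (1 - v), mul_inv, mul_one]
  have : Real.exp (-(x - z) ^ 2 / (2 * (1 - v))) = Real.exp (-(x - 0) ^ 2 / (2 * 1)) *
      Real.exp (x ^ 2 / 2 - (x - z) ^ 2 / (2 * (1 - v))) := by
    rw [← Real.exp_add]; congr 1; ring
  rw [this]
  ring

lemma integrable_gaussianReal_iff {f : ℝ → ℝ} {m : ℝ} {v : ℝ≥0} (hv : v ≠ 0) :
    Integrable f (gaussianReal m v) ↔ Integrable fun x => gaussianPDFReal m v x * f x := by
  rw [gaussianReal_of_var_ne_zero _ hv, integrable_withDensity_iff_integrable_smul₀'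
    (measurable_gaussianPDF m v).aemeasurable (Eventually.of_forall fun x => gaussianPDF_lt_top)]
  simp only [toReal_gaussianPDF, smul_eq_mul]

lemma integral_gaussianReal_eq {f : ℝ → ℝ} {m : ℝ} {v : ℝ≥0} (hv : v ≠ 0) :
    ∫ x, f x ∂(gaussianReal m v) = ∫ x, gaussianPDFReal m v x * f x := by
  rw [integral_gaussianReal_eq_integral_smul hv]
  rfl

lemma measurable_gaussLik (v : ℝ) : Measurable fun p : ℝ × ℝ => gaussLik v p.1 p.2 := by
  unfold gaussLik; fun_prop

lemma integrable_indicator_gaussLik {v : ℝ} (hv : v < 1) (z : ℝ) {s : Set ℝ}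
    (hs : MeasurableSet s) :
    Integrable (s.indicator fun x => gaussLik v x z) (gaussianReal 0 1) := by
  refine Integrable.indicator ?_ hs
  rw [integrable_gaussianReal_iff one_ne_zero]
  simp only [gaussLik_mul_gaussianPDFReal hv]
  exact integrable_gaussianPDFReal _ _

lemma integral_indicator_gaussLik {v : ℝ} (hv : v < 1) (z : ℝ) {s : Set ℝ}
    (hs : MeasurableSet s) :
    ENNReal.ofReal (∫ x, s.indicator (fun x => gaussLik v x z) x ∂(gaussianReal 0 1)) =
      gaussianReal z (1 - v).toNNReal s := by
  have hv' : (1 - v).toNNReal ≠ 0 := by simpa using hv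
  rw [integral_indicator hs, gaussianReal_apply_eq_integral _ hv']
  congr 1
  rw [← integral_indicator hs, integral_gaussianReal_eq one_ne_zero, ← integral_indicator hs]
  refine integral_congr_ae (Eventually.of_forall fun x => ?_)
  by_cases hx : x ∈ s
  · simp only [Set.indicator_of_mem hx, gaussLik_mul_gaussianPDFReal hv]
  · simp only [Set.indicator_of_notMem hx, mul_zero]

lemma pi_gaussianReal_eq_withDensity {ι : Type*} [Fintype ι] {v : ι → ℝ} (hv : ∀ i, v i < 1)
    (z : ι → ℝ) :
    Measure.pi (fun i => gaussianReal (z i) (1 - v i).toNNReal) =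
      (Measure.pi fun _ : ι => gaussianReal 0 1).withDensity
        fun x => ENNReal.ofReal (∏ i, gaussLik (v i) (x i) (z i)) := by
  refine Measure.pi_eq fun s hs => ?_
  rw [withDensity_apply _ (MeasurableSet.univ_pi hs), ← lintegral_indicator
    (MeasurableSet.univ_pi hs)]
  have : ∀ x : ι → ℝ, (Set.univ.pi s).indicator
      (fun x => ENNReal.ofReal (∏ i, gaussLik (v i) (x i) (z i))) x =
      ENNReal.ofReal (∏ i, (s i).indicator (fun x => gaussLik (v i) x (z i)) (x i)) := by
    intro x
    by_cases hx : x ∈ Set.univ.pi s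
    · rw [Set.indicator_of_mem hx]
      congr 1
      exact Finset.prod_congr rfl fun i _ => by rw [Set.indicator_of_mem (hx i trivial)]
    · rw [Set.indicator_of_notMem hx]
      simp only [Set.mem_pi, Set.mem_univ, forall_const, not_forall] at hx
      obtain ⟨i, hi⟩ := hx
      rw [Finset.prod_eq_zero (Finset.mem_univ i) (by rw [Set.indicator_of_notMem hi]),
        ENNReal.ofReal_zero]
  simp only [this]
  rw [lintegral_fintype_prod_ofReal
    (f := fun i => (s i).indicator fun x => gaussLik (v i) x (z i))
    (fun i x => Set.indicator_nonneg (fun x _ => gaussLik_nonneg _ _ _) x)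
    (fun i => integrable_indicator_gaussLik (hv i) (z i) (hs i))]
  exact Finset.prod_congr rfl fun i _ => integral_indicator_gaussLik (hv i) (z i) (hs i)

/-- Completing the square in `x`; the coefficient of the square is negative precisely because `-1 <
v < 1`. -/
lemma gaussianPDFReal_mul_gaussLik_sq {v : ℝ} (hv0 : 0 ≤ v) (hv : v < 1) (x z : ℝ) :
    gaussianPDFReal 0 1 x * gaussLik v x z ^ 2 =
      (√(2 * Real.pi))⁻¹ * (1 - v)⁻¹ * Real.exp (z ^ 2 / (1 + v)) *
        Real.exp (-((1 + v) / (2 * (1 - v))) * (x - 2 * z / (1 + v)) ^ 2) := by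
  have h1 : 0 < 1 - v := by linarith
  have h2 : 0 < 1 + v := by linarith
  rw [gaussianPDFReal, gaussLik, NNReal.coe_one, mul_one, mul_pow, inv_pow, Real.sq_sqrt h1.le,
    ← Real.exp_nat_mul]
  have : Real.exp (-(x - 0) ^ 2 / (2 * 1)) *
      Real.exp ((2 : ℕ) * (x ^ 2 / 2 - (x - z) ^ 2 / (2 * (1 - v)))) =
      Real.exp (z ^ 2 / (1 + v)) *
        Real.exp (-((1 + v) / (2 * (1 - v))) * (x - 2 * z / (1 + v)) ^ 2) := by
    rw [← Real.exp_add, ← Real.exp_add]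
    congr 1
    push_cast
    field_simp
    ring
  linear_combination ((√(2 * Real.pi))⁻¹ * (1 - v)⁻¹) * this

lemma integrable_gaussLik_sq {v : ℝ} (hv0 : 0 ≤ v) (hv : v < 1) (z : ℝ) :
    Integrable (fun x => gaussLik v x z ^ 2) (gaussianReal 0 1) := by
  have h1 : 0 < 1 - v := by linarith
  rw [integrable_gaussianReal_iff one_ne_zero]
  simp only [gaussianPDFReal_mul_gaussLik_sq hv0 hv]
  exact (integrable_exp_neg_mul_sub_sq (by positivity) _).const_mul _

lemma integral_gaussLik_sq {v : ℝ} (hv0 : 0 ≤ v) (hv : v < 1) (z : ℝ) :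
    ∫ x, gaussLik v x z ^ 2 ∂(gaussianReal 0 1) =
      (√(1 - v ^ 2))⁻¹ * Real.exp (z ^ 2 / (1 + v)) := by
  have h1 : 0 < 1 - v := by linarith
  have h2 : 0 < 1 + v := by linarith
  rw [integral_gaussianReal_eq one_ne_zero]
  simp only [gaussianPDFReal_mul_gaussLik_sq hv0 hv]
  rw [integral_const_mul, integral_exp_neg_mul_sub_sq]
  have h3 : √(Real.pi / ((1 + v) / (2 * (1 - v)))) =
      √(2 * Real.pi) * ((1 - v) * (√(1 - v ^ 2))⁻¹) := by
    have h4 : 0 < 1 - v ^ 2 := by nlinarith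
    rw [← Real.sqrt_inv, ← Real.sqrt_sq h1.le, ← Real.sqrt_mul (by positivity),
      ← Real.sqrt_mul (by positivity), Real.sqrt_sq h1.le]
    congr 1
    have : 1 - v ^ 2 = (1 - v) * (1 + v) := by ring
    rw [this]
    field_simp
  rw [h3]
  have h5 : √(2 * Real.pi) ≠ 0 := by positivity
  field_simp

/-- Writing `N(0, v)` as an image of `N(0, 1)` treats `v = 0`, where there is no density, together
with `v > 0`. -/
lemma gaussianReal_zero_eq_map {v : ℝ} (hv0 : 0 ≤ v) :
    gaussianReal 0 v.toNNReal = (gaussianReal 0 1).map (fun x => √v * x) := by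
  have h := gaussianReal_map_const_mul (μ := 0) (v := 1) (√v)
  rw [h, mul_zero, mul_one]
  congr 1
  ext
  simp [Real.sq_sqrt hv0, hv0]

lemma gaussianPDFReal_mul_exp_sq {v : ℝ} (hv0 : 0 ≤ v) (x : ℝ) :
    gaussianPDFReal 0 1 x * Real.exp ((√v * x) ^ 2 / (1 + v)) =
      (√(2 * Real.pi))⁻¹ * Real.exp (-((1 - v) / (2 * (1 + v))) * (x - 0) ^ 2) := by
  have h2 : 0 < 1 + v := by linarith
  rw [gaussianPDFReal, NNReal.coe_one, mul_one, mul_assoc, ← Real.exp_add, mul_pow,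
    Real.sq_sqrt hv0]
  congr 2
  field_simp
  ring

lemma integrable_second_moment {v : ℝ} (hv0 : 0 ≤ v) (hv : v < 1) :
    Integrable (fun z => (√(1 - v ^ 2))⁻¹ * Real.exp (z ^ 2 / (1 + v)))
      (gaussianReal 0 v.toNNReal) := by
  have h1 : 0 < 1 - v := by linarith
  have h2 : 0 < 1 + v := by linarith
  refine Integrable.const_mul ?_ _
  rw [gaussianReal_zero_eq_map hv0, integrable_map_measure
    (Measurable.aestronglyMeasurable (by fun_prop)) (by fun_prop),
    integrable_gaussianReal_iff one_ne_zero]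
  simp only [Function.comp_apply, gaussianPDFReal_mul_exp_sq hv0]
  exact (integrable_exp_neg_mul_sub_sq (by positivity) _).const_mul _

/-- Averaging over the conditional mean cancels the square root. The result is the second moment of
the likelihood ratio of a standard Gaussian pair with squared correlation `v`. -/
lemma integral_second_moment {v : ℝ} (hv0 : 0 ≤ v) (hv : v < 1) :
    ∫ z, (√(1 - v ^ 2))⁻¹ * Real.exp (z ^ 2 / (1 + v)) ∂(gaussianReal 0 v.toNNReal) =
      (1 - v)⁻¹ := by
  have h1 : 0 < 1 - v := by linarith
  have h2 : 0 < 1 + v := by linarith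
  rw [integral_const_mul, gaussianReal_zero_eq_map hv0, integral_map (by fun_prop)
    (Measurable.aestronglyMeasurable (by fun_prop)), integral_gaussianReal_eq one_ne_zero]
  simp only [gaussianPDFReal_mul_exp_sq hv0]
  rw [integral_const_mul, integral_exp_neg_mul_sub_sq]
  have h3 : √(Real.pi / ((1 - v) / (2 * (1 + v)))) =
      √(2 * Real.pi) * (√(1 - v ^ 2) * (1 - v)⁻¹) := by
    rw [← Real.sqrt_sq (inv_pos.2 h1).le, ← Real.sqrt_mul (by nlinarith),
      ← Real.sqrt_mul (by positivity)]
    congr 1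
    have : 1 - v ^ 2 = (1 - v) * (1 + v) := by ring
    rw [this]
    field_simp
  rw [h3]
  have h5 : √(2 * Real.pi) ≠ 0 := by positivity
  have h6 : √(1 - v ^ 2) ≠ 0 := (Real.sqrt_pos.2 (by nlinarith)).ne'
  field_simp

/-- Let `W` be a Gaussian vector with independent `N(0, 1 - v_i)` coordinates, independent of `Ψ`,
and let `Z = ζ(Ψ)` have independent `N(0, v_i)` coordinates. Then the discretized chi-square
divergence between the joint law of `(Ψ, Z + W)` and the product of its marginals is bounded by
`∏ (1 - v_i)⁻¹`. -/
lemma sum_sq_div_le_prod {Ω S ι κ τ : Type*} [MeasurableSpace Ω] [MeasurableSpace S] [Fintype ι]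
    [Fintype κ] [Fintype τ] {P : Measure Ω} [IsProbabilityMeasure P] {Ψ : Ω → S}
    (hΨ : Measurable Ψ) {W : Ω → τ → ℝ} (hW : Measurable W) {ζ : S → τ → ℝ} (hζ : Measurable ζ)
    (hind : IndepFun W Ψ P) {v : τ → ℝ} (hv0 : ∀ i, 0 ≤ v i) (hv : ∀ i, v i < 1)
    (hWlaw : P.map W = Measure.pi fun i => gaussianReal 0 (1 - v i).toNNReal)
    (hZlaw : P.map (fun ω => ζ (Ψ ω)) = Measure.pi fun i => gaussianReal 0 (v i).toNNReal)
    (hXlaw : P.map (fun ω => ζ (Ψ ω) + W ω) = Measure.pi fun _ => gaussianReal 0 1)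
    {C : κ → Set S} {G : ι → Set (τ → ℝ)} (hC : ∀ k, MeasurableSet (C k))
    (hG : ∀ j, MeasurableSet (G j))
    (hCd : Pairwise fun i j => Disjoint (C i) (C j))
    (hGd : Pairwise fun i j => Disjoint (G i) (G j)) :
    ∑ j, ∑ k, (P.real ((fun ω => ζ (Ψ ω) + W ω) ⁻¹' G j ∩ Ψ ⁻¹' C k)) ^ 2 /
      (P.real ((fun ω => ζ (Ψ ω) + W ω) ⁻¹' G j) * P.real (Ψ ⁻¹' C k)) ≤ ∏ i, (1 - v i)⁻¹ := by
  set γ : Measure (τ → ℝ) := Measure.pi fun _ => gaussianReal 0 1 with hγ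
  set ρ := P.map Ψ with hρ
  have : IsProbabilityMeasure ρ := P.isProbabilityMeasure_map hΨ.aemeasurable
  set D : S × (τ → ℝ) → ℝ≥0∞ := fun p =>
    ENNReal.ofReal (∏ i, gaussLik (v i) (p.2 i) (ζ p.1 i)) with hDdef
  have hD : Measurable D := by
    refine ENNReal.measurable_ofReal.comp (Finset.measurable_prod _ fun i _ => ?_)
    exact (measurable_gaussLik (v i)).comp (by fun_prop :
      Measurable fun p : S × (τ → ℝ) => (p.2 i, ζ p.1 i))
  have hX : Measurable fun ω => ζ (Ψ ω) + W ω := by fun_prop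
  have hjoint : P.map (fun ω => (W ω, Ψ ω)) = (P.map W).prod ρ :=
    (indepFun_iff_map_prod_eq_prod_map_map hW.aemeasurable hΨ.aemeasurable).1 hind
  -- Conditionally on `Ψ = y` the vector has independent `N(ζ y i, 1 - v i)` coordinates, so `D` is
  -- the density of the joint law with respect to the product of the marginals.
  have hrect : ∀ k j, P ((fun ω => ζ (Ψ ω) + W ω) ⁻¹' G j ∩ Ψ ⁻¹' C k) =
      (ρ.prod γ).withDensity D (C k ×ˢ G j) := by
    intro k j
    have hset : MeasurableSet {p : (τ → ℝ) × S | ζ p.2 + p.1 ∈ G j ∧ p.2 ∈ C k} :=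
      ((by fun_prop : Measurable fun p : (τ → ℝ) × S => ζ p.2 + p.1) (hG j)).inter
        (measurable_snd (hC k))
    have h1 : P ((fun ω => ζ (Ψ ω) + W ω) ⁻¹' G j ∩ Ψ ⁻¹' C k) =
        P.map (fun ω => (W ω, Ψ ω)) {p | ζ p.2 + p.1 ∈ G j ∧ p.2 ∈ C k} := by
      rw [Measure.map_apply (by fun_prop) hset]
      rfl
    have : IsProbabilityMeasure (P.map W) := P.isProbabilityMeasure_map hW.aemeasurable
    rw [h1, hjoint, Measure.prod_apply_symm hset, withDensity_apply _ ((hC k).prod (hG j)),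
      setLIntegral_prod _ hD.aemeasurable, ← lintegral_indicator (hC k)]
    refine lintegral_congr fun y => ?_
    by_cases hy : y ∈ C k
    · rw [Set.indicator_of_mem hy]
      have h2 : (fun x => (x, y)) ⁻¹' {p : (τ → ℝ) × S | ζ p.2 + p.1 ∈ G j ∧ p.2 ∈ C k} =
          (fun x => ζ y + x) ⁻¹' G j := by
        ext x; simp [hy]
      have h3 : (P.map W).map (fun x => ζ y + x) =
          Measure.pi fun i => gaussianReal (ζ y i) (1 - v i).toNNReal := by
        rw [hWlaw]
        have h4 : ∀ i, gaussianReal (ζ y i) (1 - v i).toNNReal =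
            (gaussianReal 0 (1 - v i).toNNReal).map (fun x => ζ y i + x) := fun i => by
          rw [gaussianReal_map_const_add, zero_add]
        simp only [h4]
        exact Measure.pi_map_pi (f := fun i x => ζ y i + x) fun i => by fun_prop
      rw [h2, ← Measure.map_apply (by fun_prop) (hG j), h3, pi_gaussianReal_eq_withDensity hv,
        withDensity_apply _ (hG j)]
    · rw [Set.indicator_of_notMem hy]
      have h2 : (fun x => (x, y)) ⁻¹' {p : (τ → ℝ) × S | ζ p.2 + p.1 ∈ G j ∧ p.2 ∈ C k} = ∅ := by
        ext x; simp [hy]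
      rw [h2, measure_empty]
  have hM : ∫⁻ p, D p ^ 2 ∂(ρ.prod γ) ≤ ENNReal.ofReal (∏ i, (1 - v i)⁻¹) := by
    rw [lintegral_prod _ (hD.pow_const 2).aemeasurable]
    have h1 : ∀ y : S, ∫⁻ x, D (y, x) ^ 2 ∂γ = ENNReal.ofReal
        (∏ i, ((√(1 - v i ^ 2))⁻¹ * Real.exp ((ζ y i) ^ 2 / (1 + v i)))) := by
      intro y
      have h2 : ∀ x, D (y, x) ^ 2 = ENNReal.ofReal (∏ i, gaussLik (v i) (x i) (ζ y i) ^ 2) := by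
        intro x
        rw [hDdef, ← ENNReal.ofReal_pow (Finset.prod_nonneg fun i _ => gaussLik_nonneg _ _ _),
          Finset.prod_pow]
      simp only [h2]
      rw [lintegral_fintype_prod_ofReal (f := fun i x => gaussLik (v i) x (ζ y i) ^ 2)
        (fun i x => sq_nonneg _) (fun i => integrable_gaussLik_sq (hv0 i) (hv i) _),
        ← ENNReal.ofReal_prod_of_nonneg fun i _ => integral_nonneg fun x => sq_nonneg _]
      simp only [integral_gaussLik_sq (hv0 _) (hv _)]
    simp only [h1]
    have h3 : Measurable fun z : τ → ℝ => ENNReal.ofReal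
        (∏ i, ((√(1 - v i ^ 2))⁻¹ * Real.exp ((z i) ^ 2 / (1 + v i)))) := by
      refine ENNReal.measurable_ofReal.comp (Finset.measurable_prod _ fun i _ => ?_)
      fun_prop
    rw [← lintegral_map h3 hζ, hρ, Measure.map_map hζ hΨ]
    change ∫⁻ z, _ ∂(P.map fun ω => ζ (Ψ ω)) ≤ _
    rw [hZlaw, lintegral_fintype_prod_ofReal
      (f := fun i z => (√(1 - v i ^ 2))⁻¹ * Real.exp (z ^ 2 / (1 + v i)))
      (fun i x => by positivity) (fun i => integrable_second_moment (hv0 i) (hv i)),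
      ← ENNReal.ofReal_prod_of_nonneg fun i _ => integral_nonneg fun x => by positivity]
    simp only [integral_second_moment (hv0 _) (hv _)]
    exact le_rfl
  have hfin := sum_sq_div_le_of_withDensity hD
    (Finset.prod_nonneg fun i _ => inv_nonneg.2 (by linarith [hv i])) hM hC hG hCd hGd
  refine le_trans (le_of_eq ?_) hfin
  refine Finset.sum_congr rfl fun j _ => Finset.sum_congr rfl fun k _ => ?_
  have e1 : P.real ((fun ω => ζ (Ψ ω) + W ω) ⁻¹' G j) = γ.real (G j) := by
    rw [← hXlaw, map_measureReal_apply hX (hG j)]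
  have e2 : P.real (Ψ ⁻¹' C k) = ρ.real (C k) := by
    rw [map_measureReal_apply hΨ (hC k)]
  rw [e1, e2]
  simp only [Measure.real, hrect]

end LevyFBM

end

noncomputable section

set_option linter.unusedSectionVars false

namespace LevyFBM

open scoped RealInnerProductSpace ENNReal NNReal

/-! ### Closed Gaussian spaces -/

section GaussianSpace

variable {Ω : Type*} [MeasurableSpace Ω] {P : Measure Ω} [IsProbabilityMeasure P]

lemma inner_Lp_eq_integral (f g : Lp ℝ 2 P) : ⟪f, g⟫ = ∫ ω, f ω * g ω ∂P := by
  rw [L2.inner_def]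
  refine integral_congr_ae (Eventually.of_forall fun ω => ?_)
  simp only [RCLike.inner_apply, conj_trivial]
  ring

lemma norm_sq_Lp_eq_integral (f : Lp ℝ 2 P) : ‖f‖ ^ 2 = ∫ ω, f ω ^ 2 ∂P := by
  rw [← real_inner_self_eq_norm_sq, inner_Lp_eq_integral]
  simp only [sq]

lemma measurable_coe_Lp (f : Lp ℝ 2 P) : Measurable (f : Ω → ℝ) := (Lp.stronglyMeasurable f).measurable

lemma integrable_coe_Lp (f : Lp ℝ 2 P) : Integrable f P := (Lp.memLp f).integrable one_le_two

lemma integral_abs_coe_Lp_le (f : Lp ℝ 2 P) : ∫ ω, |f ω| ∂P ≤ ‖f‖ := by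
  have h := sq_integral_mul_le (μ := P) (f := fun ω => |f ω|) (g := fun _ => 1)
    (measurable_coe_Lp f).abs.aestronglyMeasurable aestronglyMeasurable_const
    (fun ω => abs_nonneg _) (fun ω => zero_le_one)
    (by simpa only [sq_abs] using (Lp.memLp f).integrable_sq) (by simp)
  simp only [mul_one, sq_abs, one_pow, integral_const, probReal_univ, smul_eq_mul,
    ← norm_sq_Lp_eq_integral] at h
  exact le_of_sq_le_sq h (norm_nonneg _)

/-- The centred Gaussian elements of `L²(P)`, described by their characteristic functions. -/
def gaussianSet (P : Measure Ω) : Set (Lp ℝ 2 P) :=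
  {f | ∫ ω, f ω ∂P = 0 ∧ ∀ t : ℝ, ∫ ω, Complex.exp ((t * f ω : ℝ) * Complex.I) ∂P =
    Complex.exp ((-(t ^ 2 * ‖f‖ ^ 2 / 2) : ℝ))}

lemma integrable_exp_mul_I {f : Ω → ℝ} (hf : Measurable f) (t : ℝ) :
    Integrable (fun ω => Complex.exp ((t * f ω : ℝ) * Complex.I)) P := by
  refine Integrable.of_bound (C := 1) (Measurable.aestronglyMeasurable (by fun_prop))
    (Eventually.of_forall fun ω => ?_)
  rw [Complex.norm_exp_ofReal_mul_I]

lemma norm_exp_mul_I_sub_le (x y : ℝ) :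
    ‖Complex.exp (x * Complex.I) - Complex.exp (y * Complex.I)‖ ≤ |x - y| := by
  have h : Complex.exp (x * Complex.I) - Complex.exp (y * Complex.I) =
      Complex.exp (y * Complex.I) * (Complex.exp (Complex.I * ((x - y : ℝ) : ℂ)) - 1) := by
    rw [mul_sub, ← Complex.exp_add, mul_one]
    congr 2
    push_cast
    ring
  rw [h, norm_mul, Complex.norm_exp_ofReal_mul_I, one_mul]
  exact Real.norm_exp_I_mul_ofReal_sub_one_le

lemma continuous_integral_exp_mul_I (t : ℝ) :
    Continuous fun f : Lp ℝ 2 P => ∫ ω, Complex.exp ((t * f ω : ℝ) * Complex.I) ∂P := by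
  refine LipschitzWith.continuous (K := ⟨|t|, abs_nonneg t⟩) (LipschitzWith.of_dist_le_mul
    fun f g => ?_)
  rw [dist_eq_norm, dist_eq_norm, ← integral_sub (integrable_exp_mul_I (measurable_coe_Lp f) t)
    (integrable_exp_mul_I (measurable_coe_Lp g) t)]
  calc ‖∫ ω, (Complex.exp ((t * f ω : ℝ) * Complex.I) -
        Complex.exp ((t * g ω : ℝ) * Complex.I)) ∂P‖
      ≤ ∫ ω, |t| * |(f - g) ω| ∂P := by
        refine norm_integral_le_of_norm_le ((integrable_coe_Lp (f - g)).abs.const_mul _) ?_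
        filter_upwards [Lp.coeFn_sub f g] with ω hω
        refine (norm_exp_mul_I_sub_le _ _).trans (le_of_eq ?_)
        rw [hω, Pi.sub_apply, ← abs_mul, mul_sub]
    _ = |t| * ∫ ω, |(f - g) ω| ∂P := integral_const_mul _ _
    _ ≤ |t| * ‖f - g‖ := by gcongr; exact integral_abs_coe_Lp_le _

lemma continuous_integral_coe_Lp : Continuous fun f : Lp ℝ 2 P => ∫ ω, f ω ∂P := by
  refine LipschitzWith.continuous (K := 1) (LipschitzWith.of_dist_le_mul fun f g => ?_)
  rw [dist_eq_norm, dist_eq_norm, ← integral_sub (integrable_coe_Lp f) (integrable_coe_Lp g),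
    NNReal.coe_one, one_mul]
  refine le_trans ?_ (integral_abs_coe_Lp_le (f - g))
  refine norm_integral_le_of_norm_le (integrable_coe_Lp (f - g)).abs ?_
  filter_upwards [Lp.coeFn_sub f g] with ω hω
  rw [hω, Pi.sub_apply, Real.norm_eq_abs]

/-- The mean and the characteristic function are Lipschitz in the `L²` norm, so Gaussianity passes
to limits and hence to closed spans. -/
lemma isClosed_gaussianSet : IsClosed (gaussianSet P) := by
  have h : gaussianSet P = {f | ∫ ω, f ω ∂P = 0} ∩
      ⋂ t : ℝ, {f | ∫ ω, Complex.exp ((t * f ω : ℝ) * Complex.I) ∂P =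
        Complex.exp ((-(t ^ 2 * ‖f‖ ^ 2 / 2) : ℝ))} := by
    ext f
    simp only [Set.mem_inter_iff, Set.mem_iInter]
    rfl
  rw [h]
  exact (isClosed_eq continuous_integral_coe_Lp continuous_const).inter
    (isClosed_iInter fun t => isClosed_eq (continuous_integral_exp_mul_I t) (by fun_prop))

lemma variance_coe_Lp {f : Lp ℝ 2 P} (hf : ∫ ω, f ω ∂P = 0) : Var[f; P] = ‖f‖ ^ 2 := by
  rw [variance_of_integral_eq_zero (measurable_coe_Lp f).aemeasurable hf,
    norm_sq_Lp_eq_integral]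

lemma covariance_coe_Lp {f g : Lp ℝ 2 P} (hf : ∫ ω, f ω ∂P = 0) :
    cov[f, g; P] = ⟪f, g⟫ := by
  rw [covariance_eq_sub (Lp.memLp f) (Lp.memLp g), hf, zero_mul, sub_zero, inner_Lp_eq_integral]
  rfl

lemma mem_gaussianSet_of_hasGaussianLaw {f : Lp ℝ 2 P} (hf : HasGaussianLaw f P)
    (hf0 : ∫ ω, f ω ∂P = 0) : f ∈ gaussianSet P := by
  refine ⟨hf0, fun t => ?_⟩
  have h1 := hf.map_eq_gaussianReal
  rw [hf0, variance_coe_Lp hf0] at h1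
  have h2 : charFun (P.map f) t = ∫ ω, Complex.exp ((t * f ω : ℝ) * Complex.I) ∂P := by
    rw [charFun_apply_real, integral_map (measurable_coe_Lp f).aemeasurable (by fun_prop)]
    push_cast
    rfl
  rw [← h2, h1, charFun_gaussianReal, Real.coe_toNNReal _ (sq_nonneg _)]
  congr 1
  push_cast
  ring

lemma coeFn_sum_smul {ι : Type*} (s : Finset ι) (c : ι → ℝ) (f : ι → Lp ℝ 2 P) :
    ((∑ i ∈ s, c i • f i : Lp ℝ 2 P) : Ω → ℝ) =ᵐ[P] fun ω => ∑ i ∈ s, c i * f i ω := by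
  classical
  induction s using Finset.induction_on with
  | empty =>
    simp only [Finset.sum_empty]
    exact Lp.coeFn_zero ℝ 2 P
  | insert i s hi ih =>
    rw [Finset.sum_insert hi]
    filter_upwards [Lp.coeFn_add (c i • f i) (∑ i ∈ s, c i • f i), Lp.coeFn_smul (c i) (f i), ih]
      with ω h1 h2 h3
    rw [h1, Pi.add_apply, h2, h3, Finset.sum_insert hi]
    rfl

/-- The elements of a subspace of `L²(P)` consisting of centred Gaussian variables are jointly
Gaussian. -/
lemma isGaussianProcess_of_le_gaussianSet {V : Submodule ℝ (Lp ℝ 2 P)}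
    (hV : (V : Set (Lp ℝ 2 P)) ⊆ gaussianSet P) :
    IsGaussianProcess (fun (h : V) (ω : Ω) => (h : Lp ℝ 2 P) ω) P := by
  refine ⟨fun I => ?_⟩
  have hmeas : Measurable fun ω => I.restrict fun h : V => (h : Lp ℝ 2 P) ω :=
    measurable_pi_lambda _ fun i => measurable_coe_Lp _
  refine (hasGaussianLaw_iff_charFunDual_map_eq hmeas.aemeasurable).2 fun L => ?_
  classical
  -- A linear functional of finitely many elements is again an element of `V`, so its characteristic
  -- function is already known; this gives joint Gaussianity.
  set f : Lp ℝ 2 P := ∑ i : I, L (Pi.single i 1) • ((i : V) : Lp ℝ 2 P) with hf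
  have hfV : f ∈ V := V.sum_mem fun i _ => V.smul_mem _ (i : V).2
  obtain ⟨h0, h1⟩ := hV hfV
  have hLf : (L ∘ fun ω => I.restrict fun h : V => (h : Lp ℝ 2 P) ω) =ᵐ[P] f := by
    filter_upwards [coeFn_sum_smul Finset.univ (fun i : I => L (Pi.single i 1))
      (fun i => ((i : V) : Lp ℝ 2 P))] with ω hω
    rw [hf, hω, Function.comp_apply]
    conv_lhs => rw [← Finset.univ_sum_single (I.restrict fun h : V => (h : Lp ℝ 2 P) ω), map_sum]
    refine Finset.sum_congr rfl fun i _ => ?_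
    rw [← mul_one (I.restrict _ i), ← smul_eq_mul, Pi.single_smul, map_smul, smul_eq_mul, mul_comm]
    rfl
  rw [integral_congr_ae hLf, variance_congr hLf, h0, variance_coe_Lp h0, charFunDual_apply,
    integral_map hmeas.aemeasurable (by fun_prop)]
  have h2 := h1 1
  simp only [one_mul, one_pow] at h2
  calc _ = ∫ ω, Complex.exp ((f ω : ℝ) * Complex.I) ∂P := by
        refine integral_congr_ae ?_
        filter_upwards [hLf] with ω hω
        rw [← hω]
        rfl
    _ = _ := by
        rw [h2]
        congr 1
        push_cast
        ring

lemma map_coe_Lp_eq_gaussianReal {V : Submodule ℝ (Lp ℝ 2 P)}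
    (hV : (V : Set (Lp ℝ 2 P)) ⊆ gaussianSet P) {f : Lp ℝ 2 P} (hf : f ∈ V) :
    P.map f = gaussianReal 0 (‖f‖ ^ 2).toNNReal := by
  have h := ((isGaussianProcess_of_le_gaussianSet hV).hasGaussianLaw_eval ⟨f, hf⟩).map_eq_gaussianReal
  simp only at h
  rw [h, (hV hf).1, variance_coe_Lp (hV hf).1]

/-- Pairwise orthogonal elements of a Gaussian space are independent centred Gaussian variables. -/
lemma map_pi_eq_pi_gaussianReal {V : Submodule ℝ (Lp ℝ 2 P)}
    (hV : (V : Set (Lp ℝ 2 P)) ⊆ gaussianSet P) {τ : Type*} [Fintype τ] (f : τ → Lp ℝ 2 P)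
    (hf : ∀ i, f i ∈ V) (horth : ∀ i j, i ≠ j → ⟪f i, f j⟫ = 0) :
    P.map (fun ω i => f i ω) = Measure.pi fun i => gaussianReal 0 (‖f i‖ ^ 2).toNNReal := by
  have hproc := (isGaussianProcess_of_le_gaussianSet hV).comp_right fun i => (⟨f i, hf i⟩ : V)
  have hind : iIndepFun (fun i ω => f i ω) P := by
    refine HasGaussianLaw.iIndepFun_of_covariance_eq_zero ?_ fun i j hij => ?_
    · have h1 := hproc.hasGaussianLaw Finset.univ
      exact h1.map_equiv_fun (ContinuousLinearEquiv.piCongrLeft ℝ (fun _ : τ => ℝ)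
        (Equiv.subtypeUnivEquiv (fun i => Finset.mem_univ i)))
    · exact (covariance_coe_Lp (hV (hf i)).1).trans (horth i j hij)
  rw [(iIndepFun_iff_map_fun_eq_pi_map
    fun i => (measurable_coe_Lp (f i)).aemeasurable).1 hind]
  congr 1
  ext1 i
  exact map_coe_Lp_eq_gaussianReal hV (hf i)

end GaussianSpace

end LevyFBM

end

noncomputable section

set_option linter.unusedSectionVars false

namespace LevyFBM

open scoped RealInnerProductSpace ENNReal NNReal

/-! ### Chi-square bound for Gaussian spaces -/

section ChiSquare

/-- A finite-dimensional subspace has an orthonormal basis which the orthogonal projection to a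
given subspace maps to pairwise orthogonal vectors. -/
lemma exists_orthonormalBasis_inner_starProjection_eq_zero {F : Type*} [NormedAddCommGroup F]
    [InnerProductSpace ℝ F] (A B : Submodule ℝ F) [FiniteDimensional ℝ A]
    [B.HasOrthogonalProjection] :
    ∃ (N : ℕ) (e : OrthonormalBasis (Fin N) ℝ A), ∀ i j, i ≠ j →
      ⟪B.starProjection (e i : F), B.starProjection (e j : F)⟫ = 0 := by
  -- `T` compresses the projection on `B` to `A`. It is symmetric, and its eigenvectors are the
  -- canonical variables of the pair.
  set T : A →ₗ[ℝ] A :=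
    (A.orthogonalProjectionOnto.comp (B.starProjection.comp A.subtypeL)).toLinearMap with hT
  have hTin : ∀ x y : A, ⟪T x, y⟫ = ⟪B.starProjection (x : F), B.starProjection (y : F)⟫ := by
    intro x y
    have h1 : ⟪T x, y⟫ = ⟪B.starProjection (x : F), (y : F)⟫ :=
      Submodule.inner_orthogonalProjectionOnto_eq_of_mem_right y _
    rw [h1, Submodule.inner_starProjection_left_eq_right, ← Submodule.inner_starProjection_left_eq_right,
      ← Submodule.inner_starProjection_left_eq_right]
    congr 1
    exact (Submodule.starProjection_eq_self_iff.2 (Submodule.starProjection_apply_mem B _)).symm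
  have hsym : T.IsSymmetric := by
    intro x y
    rw [hTin, ← real_inner_comm, ← hTin y x]
    exact real_inner_comm _ _
  refine ⟨Module.finrank ℝ A, hsym.eigenvectorBasis rfl, fun i j hij => ?_⟩
  rw [← hTin, hsym.apply_eigenvectorBasis, real_inner_smul_left,
    (hsym.eigenvectorBasis rfl).orthonormal.2 hij, mul_zero]

variable {Ω : Type*} [MeasurableSpace Ω] {P : Measure Ω} [IsProbabilityMeasure P]

/-- The evaluation map of the variables in a set of elements of `L²(P)`. -/
def evalMap (A : Set (Lp ℝ 2 P)) (ω : Ω) : A → ℝ := fun h => (h : Lp ℝ 2 P) ω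

lemma measurable_evalMap (A : Set (Lp ℝ 2 P)) : Measurable (evalMap A) :=
  measurable_pi_lambda _ fun _ => measurable_coe_Lp _

lemma inv_one_sub_le_exp {v : ℝ} (hv0 : 0 ≤ v) (hv : v ≤ 1 / 2) :
    (1 - v)⁻¹ ≤ Real.exp (2 * v) := by
  have h1 : 2 * v + 1 ≤ Real.exp (2 * v) := Real.add_one_le_exp _
  refine le_trans ?_ h1
  rw [inv_le_iff_one_le_mul₀ (by linarith)]
  nlinarith

/-- Chi-square bound: if the projection to `B` has small Hilbert-Schmidt norm on the
finite-dimensional Gaussian space `A`, then events determined by `A` and `B` are almost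
independent. -/
lemma sum_sq_div_le_exp {V A B : Submodule ℝ (Lp ℝ 2 P)} [FiniteDimensional ℝ A]
    [B.HasOrthogonalProjection] (hV : (V : Set (Lp ℝ 2 P)) ⊆ gaussianSet P) (hA : A ≤ V)
    (hB : B ≤ V) {M : ℝ} (hM : M ≤ 1 / 2)
    (hHS : ∀ (N : ℕ) (U : Fin N → Lp ℝ 2 P), (∀ k, U k ∈ A) → Orthonormal ℝ U →
      ∑ k, ‖B.starProjection (U k)‖ ^ 2 ≤ M)
    {α ι κ : Type*} [Fintype ι] [Fintype κ] [Fintype α] (h : α → Lp ℝ 2 P) (hh : ∀ i, h i ∈ A)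
    {G : ι → Set (α → ℝ)} (hG : ∀ j, MeasurableSet (G j))
    (hGd : Pairwise fun i j => Disjoint (G i) (G j))
    {C : κ → Set (B → ℝ)} (hC : ∀ k, MeasurableSet (C k))
    (hCd : Pairwise fun i j => Disjoint (C i) (C j)) :
    ∑ j, ∑ k, (P.real ((fun ω i => h i ω) ⁻¹' G j ∩ evalMap (B : Set (Lp ℝ 2 P)) ⁻¹' C k)) ^ 2 /
      (P.real ((fun ω i => h i ω) ⁻¹' G j) * P.real (evalMap (B : Set (Lp ℝ 2 P)) ⁻¹' C k)) ≤
      Real.exp (2 * M) := by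
  obtain ⟨N, e, he⟩ := exists_orthonormalBasis_inner_starProjection_eq_zero A B
  set f : Fin N → Lp ℝ 2 P := fun i => (e i : Lp ℝ 2 P) with hf
  have hfA : ∀ i, f i ∈ A := fun i => (e i).2
  have hfo : Orthonormal ℝ f := e.orthonormal.comp_linearIsometry A.subtypeₗᵢ
  set Z : Fin N → Lp ℝ 2 P := fun i => B.starProjection (f i) with hZ
  have hZB : ∀ i, Z i ∈ B := fun i => Submodule.starProjection_apply_mem B _
  -- The residual is orthogonal to `B`, hence independent of all of `B` by joint Gaussianity inside
  -- `V`.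
  set W : Fin N → Lp ℝ 2 P := fun i => f i - Z i with hW
  have hWV : ∀ i, W i ∈ V := fun i => V.sub_mem (hA (hfA i)) (hB (hZB i))
  have hWB : ∀ i, ∀ b ∈ B, ⟪W i, b⟫ = 0 := fun i b hb =>
    Submodule.starProjection_inner_eq_zero (f i) b hb
  set v : Fin N → ℝ := fun i => ‖Z i‖ ^ 2 with hv
  have hv0 : ∀ i, 0 ≤ v i := fun i => sq_nonneg _
  have hvsum : ∑ i, v i ≤ M := hHS N f hfA hfo
  have hvM : ∀ i, v i ≤ 1 / 2 := fun i =>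
    ((Finset.single_le_sum (f := v) (fun i _ => hv0 i) (Finset.mem_univ i)).trans hvsum).trans hM
  have hff : ∀ i j, ⟪f i, f j⟫ = ⟪Z i, Z j⟫ + ⟪W i, W j⟫ := by
    intro i j
    have h1 : f i = Z i + W i := by simp [hW]
    have h2 : f j = Z j + W j := by simp [hW]
    rw [h1, h2, inner_add_left, inner_add_right, inner_add_right, hWB i _ (hZB j),
      real_inner_comm (W j) (Z i), hWB j _ (hZB i)]
    ring
  have hWnorm : ∀ i, ‖W i‖ ^ 2 = 1 - v i := by
    intro i
    have := hff i i
    rw [real_inner_self_eq_norm_sq, real_inner_self_eq_norm_sq, real_inner_self_eq_norm_sq,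
      hfo.1 i] at this
    simp only [hv]
    linarith
  have hWorth : ∀ i j, i ≠ j → ⟪W i, W j⟫ = 0 := by
    intro i j hij
    have := hff i j
    rw [hfo.2 hij, he i j hij] at this
    linarith
  have hind : IndepFun (fun ω i => W i ω) (evalMap (B : Set (Lp ℝ 2 P))) P := by
    refine IsGaussianProcess.indepFun_of_covariance_eq_zero
      (X := fun i ω => W i ω) (Y := fun (b : B) ω => (b : Lp ℝ 2 P) ω) ?_
      (fun i => (measurable_coe_Lp _).aemeasurable) (fun b => (measurable_coe_Lp _).aemeasurable)
      fun i b => ?_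
    · have h1 := (isGaussianProcess_of_le_gaussianSet hV).comp_right
        (Sum.elim (fun i => (⟨W i, hWV i⟩ : V)) fun b : B => ⟨b, hB b.2⟩)
      refine h1.congr fun x => ?_
      cases x <;> exact ae_eq_refl _
    · exact (covariance_coe_Lp (hV (hWV i)).1).trans (hWB i b b.2)
  set ζ : (B → ℝ) → Fin N → ℝ := fun y i => y ⟨Z i, hZB i⟩ with hζ
  have hζm : Measurable ζ := measurable_pi_lambda _ fun i => measurable_pi_apply _
  have hX : (fun ω => ζ (evalMap (B : Set (Lp ℝ 2 P)) ω) + fun i => W i ω) =ᵐ[P]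
      fun ω i => f i ω := by
    have : ∀ᵐ ω ∂P, ∀ i, W i ω = f i ω - Z i ω :=
      ae_all_iff.2 fun i => Lp.coeFn_sub (f i) (Z i)
    filter_upwards [this] with ω hω
    ext i
    rw [Pi.add_apply, hω]
    simp only [hζ, evalMap]
    ring
  have hWlaw : P.map (fun ω i => W i ω) = Measure.pi fun i => gaussianReal 0 (1 - v i).toNNReal := by
    rw [map_pi_eq_pi_gaussianReal hV W hWV hWorth]
    simp only [hWnorm]
  have hZlaw : P.map (fun ω => ζ (evalMap (B : Set (Lp ℝ 2 P)) ω)) =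
      Measure.pi fun i => gaussianReal 0 (v i).toNNReal :=
    map_pi_eq_pi_gaussianReal hV Z (fun i => hB (hZB i)) he
  have hXlaw : P.map (fun ω => ζ (evalMap (B : Set (Lp ℝ 2 P)) ω) + fun i => W i ω) =
      Measure.pi fun _ => gaussianReal 0 1 := by
    rw [Measure.map_congr hX, map_pi_eq_pi_gaussianReal hV f (fun i => hA (hfA i))
      fun i j hij => hfo.2 hij]
    simp [hfo.1]
  -- The given variables are almost surely linear functions of the canonical coordinates, so their
  -- events pull back to events of those coordinates.
  set L : (Fin N → ℝ) → α → ℝ := fun x k => ∑ i, ⟪f i, h k⟫ * x i with hL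
  have hLm : Measurable L := by fun_prop
  have hhL : (fun ω i => h i ω) =ᵐ[P]
      fun ω => L (ζ (evalMap (B : Set (Lp ℝ 2 P)) ω) + fun i => W i ω) := by
    have h1 : ∀ k, h k = ∑ i, ⟪f i, h k⟫ • f i := by
      intro k
      have h2 := congrArg (fun x : A => (x : Lp ℝ 2 P)) (e.sum_repr' ⟨h k, hh k⟩)
      simp only [Submodule.coe_sum, Submodule.coe_smul] at h2
      exact h2.symm
    have h2 : ∀ᵐ ω ∂P, ∀ k, h k ω = ∑ i, ⟪f i, h k⟫ * f i ω := by
      refine ae_all_iff.2 fun k => ?_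
      have := coeFn_sum_smul (P := P) Finset.univ (fun i => ⟪f i, h k⟫) f
      rwa [← h1 k] at this
    filter_upwards [h2, hX] with ω h3 h4
    ext k
    rw [h4, h3]
  have key := sum_sq_div_le_prod (measurable_evalMap (B : Set (Lp ℝ 2 P)))
    (W := fun ω i => W i ω) (measurable_pi_lambda _ fun i => measurable_coe_Lp _) hζm hind hv0
    (fun i => lt_of_le_of_lt (hvM i) (by norm_num)) hWlaw hZlaw hXlaw hC
    (fun j => hLm (hG j)) hCd fun i j hij => (hGd hij).preimage L
  have hev : ∀ j D, P.real ((fun ω i => h i ω) ⁻¹' G j ∩ D) = P.real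
      ((fun ω => ζ (evalMap (B : Set (Lp ℝ 2 P)) ω) + fun i => W i ω) ⁻¹' (L ⁻¹' G j) ∩ D) := by
    intro j D
    refine measureReal_congr (eventuallyEq_set.2 ?_)
    filter_upwards [hhL] with ω hω
    simp only [Set.mem_inter_iff, Set.mem_preimage, hω]
  have hev' := fun j => hev j Set.univ
  simp only [Set.inter_univ] at hev'
  refine le_trans (le_of_eq ?_) (key.trans ?_)
  · refine Finset.sum_congr rfl fun j _ => Finset.sum_congr rfl fun k _ => ?_
    rw [hev' j, hev j]
  · calc ∏ i, (1 - v i)⁻¹ ≤ ∏ i, Real.exp (2 * v i) :=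
          Finset.prod_le_prod (fun i _ => inv_nonneg.2 (by linarith [hvM i]))
            fun i _ => inv_one_sub_le_exp (hv0 i) (hvM i)
      _ = Real.exp (2 * ∑ i, v i) := by rw [← Real.exp_sum, Finset.mul_sum]
      _ ≤ Real.exp (2 * M) := by gcongr

end ChiSquare

end LevyFBM

end

noncomputable section

set_option linter.unusedSectionVars false

namespace LevyFBM

open scoped RealInnerProductSpace ENNReal NNReal symmDiff

/-! ### Mutual information of Gaussian spaces -/

section MutualInfo

/-- Points lying in several of the sets are dropped altogether. The union may shrink, but only
disjointness is needed. -/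
lemma disjointification_disjoint {S ι : Type*} (T : ι → Set S) :
    Pairwise fun i j => Disjoint (T i \ ⋃ k ≠ i, T k) (T j \ ⋃ k ≠ j, T k) := by
  intro i j hij
  rw [Set.disjoint_left]
  intro x hx hx'
  exact hx.2 (Set.mem_iUnion₂.2 ⟨j, hij.symm, hx'.1⟩)

lemma measurableSet_disjointification {S ι : Type*} [MeasurableSpace S] [Finite ι] {T : ι → Set S}
    (hT : ∀ i, MeasurableSet (T i)) (i : ι) : MeasurableSet (T i \ ⋃ k ≠ i, T k) := by
  have := Fintype.ofFinite ι
  exact (hT i).diff (MeasurableSet.iUnion fun k => MeasurableSet.iUnion fun _ => hT k)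

variable {Ω : Type*} [MeasurableSpace Ω] {P : Measure Ω} [IsProbabilityMeasure P]

lemma sigmaOf_eq_comap (A : Submodule ℝ (Lp ℝ 2 P)) :
    sigmaOf A = MeasurableSpace.comap (evalMap (A : Set (Lp ℝ 2 P))) MeasurableSpace.pi := by
  rw [MeasurableSpace.pi, MeasurableSpace.comap_iSup]
  simp only [MeasurableSpace.comap_comp]
  rfl

lemma sigmaOf_le (A : Submodule ℝ (Lp ℝ 2 P)) : sigmaOf A ≤ ‹MeasurableSpace Ω› := by
  rw [sigmaOf_eq_comap]
  exact (measurable_evalMap _).comap_le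

/-- Disjoint events of `σ(A)` are approximated by disjoint events depending on finitely many
variables. -/
lemma exists_finset_approx (A : Submodule ℝ (Lp ℝ 2 P)) {m : ℕ} {S : Fin m → Set Ω}
    (hS : ∀ j, MeasurableSet[sigmaOf A] (S j))
    (hSd : Pairwise fun i j => Disjoint (S i) (S j)) {δ : ℝ} (hδ : 0 < δ) :
    ∃ (F : Finset A) (G : Fin m → Set (F → ℝ)), (∀ j, MeasurableSet (G j)) ∧
      (Pairwise fun i j => Disjoint (G i) (G j)) ∧
      ∀ j, P.real (S j ∆ ((fun ω (i : F) => ((i : A) : Lp ℝ 2 P) ω) ⁻¹' G j)) ≤ m * δ := by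
  classical
  rw [sigmaOf_eq_comap] at hS
  choose C hC hCS using hS
  set μ : Measure (A → ℝ) := P.map (evalMap (A : Set (Lp ℝ 2 P))) with hμ
  have hev := measurable_evalMap (A : Set (Lp ℝ 2 P))
  have : IsProbabilityMeasure μ := P.isProbabilityMeasure_map hev.aemeasurable
  -- Cylinder sets form an algebra generating the product σ-algebra, hence approximate every
  -- measurable set in measure.
  have hdense := Measure.MeasureDense.of_generateFrom_isSetAlgebra_finite μ
    (isSetAlgebra_measurableCylinders (α := fun _ : A => ℝ)) generateFrom_measurableCylinders.symm
  choose T hT hTC using fun j => hdense.approx (C j) (hC j) (measure_ne_top _ _) δ hδ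
  choose F₀ G₀ hG₀ hTG using fun j => (mem_measurableCylinders (T j)).1 (hT j)
  set F : Finset A := Finset.univ.biUnion F₀ with hF
  have hsub : ∀ j, F₀ j ⊆ F := fun j => Finset.subset_biUnion_of_mem F₀ (Finset.mem_univ j)
  set T' : Fin m → Set (F → ℝ) := fun j =>
    Finset.restrict₂ (π := fun _ : A => ℝ) (hsub j) ⁻¹' G₀ j with hT'
  have hT'm : ∀ j, MeasurableSet (T' j) := fun j =>
    Finset.measurable_restrict₂ (hsub j) (hG₀ j)
  refine ⟨F, fun j => T' j \ ⋃ k ≠ j, T' k, measurableSet_disjointification hT'm,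
    disjointification_disjoint T', fun j => ?_⟩
  set Q : Ω → F → ℝ := fun ω i => ((i : A) : Lp ℝ 2 P) ω with hQ
  have hQT : ∀ i ω, Q ω ∈ T' i ↔ ω ∈ evalMap (A : Set (Lp ℝ 2 P)) ⁻¹' T i := by
    intro i ω
    rw [hTG i]
    rfl
  -- Where every approximation is exact, disjointness of the `S i` makes the disjointification
  -- change nothing; so the error is at most the sum of all `m` errors.
  have hsubset : S j ∆ (Q ⁻¹' (T' j \ ⋃ k ≠ j, T' k)) ⊆
      ⋃ i, S i ∆ (evalMap (A : Set (Lp ℝ 2 P)) ⁻¹' T i) := by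
    intro ω hω
    by_contra hcon
    simp only [Set.mem_iUnion, not_exists, Set.mem_symmDiff, not_or, not_and, not_not] at hcon
    have hiff : ∀ i, ω ∈ S i ↔ Q ω ∈ T' i := fun i => by
      rw [hQT]; exact ⟨(hcon i).1, (hcon i).2⟩
    have : ω ∈ S j ↔ ω ∈ Q ⁻¹' (T' j \ ⋃ k ≠ j, T' k) := by
      rw [Set.mem_preimage, Set.mem_sdiff, ← hiff j]
      refine ⟨fun h => ⟨h, fun h' => ?_⟩, fun h => h.1⟩
      obtain ⟨k, hk, hk'⟩ := Set.mem_iUnion₂.1 h'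
      exact Set.disjoint_left.1 (hSd hk) ((hiff k).2 hk') h
    rw [Set.mem_symmDiff] at hω
    tauto
  have hone : ∀ i, P.real (S i ∆ (evalMap (A : Set (Lp ℝ 2 P)) ⁻¹' T i)) ≤ δ := by
    intro i
    have h1 : S i ∆ (evalMap (A : Set (Lp ℝ 2 P)) ⁻¹' T i) =
        evalMap (A : Set (Lp ℝ 2 P)) ⁻¹' (C i ∆ T i) := by
      rw [Set.preimage_symmDiff, hCS]
    rw [h1, ← map_measureReal_apply hev ((hC i).symmDiff (hdense.measurable _ (hT i)))]
    exact ENNReal.toReal_le_of_le_ofReal hδ.le (hTC i).le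
  calc _ ≤ P.real (⋃ i, S i ∆ (evalMap (A : Set (Lp ℝ 2 P)) ⁻¹' T i)) := measureReal_mono hsubset
    _ ≤ ∑ i, P.real (S i ∆ (evalMap (A : Set (Lp ℝ 2 P)) ⁻¹' T i)) :=
        measureReal_iUnion_fintype_le _
    _ ≤ ∑ _i : Fin m, δ := Finset.sum_le_sum fun i _ => hone i
    _ = m * δ := by simp

lemma abs_measureReal_inter_sub_le {S T D : Set Ω} (hS : MeasurableSet S) (hT : MeasurableSet T)
    (hD : MeasurableSet D) : |P.real (T ∩ D) - P.real (S ∩ D)| ≤ P.real (S ∆ T) := by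
  have h := abs_measureReal_sub_le_measureReal_symmDiff (μ := P) (hT.inter hD).nullMeasurableSet
    (hS.inter hD).nullMeasurableSet
  refine h.trans (measureReal_mono fun ω hω => ?_)
  simp only [Set.mem_symmDiff, Set.mem_inter_iff] at hω ⊢
  tauto

/-- Chi-square bound for the partitions of two Gaussian spaces. -/
lemma sum_sq_div_le_exp_of_isMeasPartition {V A B : Submodule ℝ (Lp ℝ 2 P)}
    [B.HasOrthogonalProjection] (hV : (V : Set (Lp ℝ 2 P)) ⊆ gaussianSet P) (hA : A ≤ V)
    (hB : B ≤ V) {M : ℝ} (hM : M ≤ 1 / 2)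
    (hHS : ∀ (N : ℕ) (U : Fin N → Lp ℝ 2 P), (∀ k, U k ∈ A) → Orthonormal ℝ U →
      ∑ k, ‖B.starProjection (U k)‖ ^ 2 ≤ M)
    {m l : ℕ} {S : Fin m → Set Ω} {R : Fin l → Set Ω} (hS : IsMeasPartition (sigmaOf A) P S)
    (hR : IsMeasPartition (sigmaOf B) P R) :
    ∑ j, ∑ k, P.real (S j ∩ R k) ^ 2 / (P.real (S j) * P.real (R k)) ≤ Real.exp (2 * M) := by
  have hRm := hR.measurableSet
  rw [sigmaOf_eq_comap] at hRm
  choose C₀ hC₀ hCR₀ using hRm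
  -- The `C₀ k` need be disjoint only on the range of `evalMap`; removing overlaps does not affect
  -- their preimages.
  set C : Fin l → Set (B → ℝ) := fun k => C₀ k \ ⋃ i ≠ k, C₀ i with hC
  have hCm : ∀ k, MeasurableSet (C k) := measurableSet_disjointification hC₀
  have hCd : Pairwise fun i j => Disjoint (C i) (C j) := disjointification_disjoint C₀
  have hCR : ∀ k, evalMap (B : Set (Lp ℝ 2 P)) ⁻¹' C k = R k := by
    intro k
    ext ω
    have hiff : ∀ i, ω ∈ R i ↔ evalMap (B : Set (Lp ℝ 2 P)) ω ∈ C₀ i := fun i => by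
      rw [← hCR₀ i]; rfl
    rw [Set.mem_preimage, Set.mem_sdiff, ← hiff k]
    refine ⟨fun h => h.1, fun h => ⟨h, fun h' => ?_⟩⟩
    obtain ⟨i, hi, hi'⟩ := Set.mem_iUnion₂.1 h'
    exact Set.disjoint_left.1 (hR.disjoint hi) ((hiff i).2 hi') h
  have hSm : ∀ j, MeasurableSet (S j) := fun j => sigmaOf_le A _ (hS.measurableSet j)
  have hRm' : ∀ k, MeasurableSet (R k) := fun k => sigmaOf_le B _ (hR.measurableSet k)
  have hδ : ∀ q : ℕ, (0 : ℝ) < 1 / ((q : ℝ) + 1) := fun q => Nat.one_div_pos_of_nat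
  choose F G hG hGd hGS using fun q => exists_finset_approx A hS.measurableSet hS.disjoint (hδ q)
  set Q : ∀ q : ℕ, Fin m → Set Ω :=
    fun q j => (fun ω (i : F q) => ((i : A) : Lp ℝ 2 P) ω) ⁻¹' G q j with hQ
  have hQm : ∀ q j, MeasurableSet (Q q j) := fun q j =>
    (measurable_pi_lambda _ fun _ => measurable_coe_Lp _) (hG q j)
  have hbound : ∀ q, ∑ j, ∑ k, P.real (Q q j ∩ R k) ^ 2 / (P.real (Q q j) * P.real (R k)) ≤
      Real.exp (2 * M) := by
    intro q
    set A₀ : Submodule ℝ (Lp ℝ 2 P) :=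
      Submodule.span ℝ (Set.range fun i : F q => ((i : A) : Lp ℝ 2 P)) with hA₀
    have hA₀A : A₀ ≤ A := by
      rw [hA₀, Submodule.span_le]
      rintro _ ⟨i, rfl⟩
      exact (i : A).2
    have : FiniteDimensional ℝ A₀ := FiniteDimensional.span_of_finite ℝ (Set.finite_range _)
    have h := sum_sq_div_le_exp hV (hA₀A.trans hA) hB hM
      (fun N U hU hUo => hHS N U (fun k => hA₀A (hU k)) hUo)
      (fun i : F q => ((i : A) : Lp ℝ 2 P)) (fun i => Submodule.subset_span ⟨i, rfl⟩)
      (hG q) (hGd q) hCm hCd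
    simpa only [hCR] using h
  have hzero : Tendsto (fun q : ℕ => (m : ℝ) * (1 / ((q : ℝ) + 1))) atTop (𝓝 0) := by
    simpa using tendsto_one_div_add_atTop_nhds_zero_nat.const_mul (m : ℝ)
  have hlim : ∀ j D, MeasurableSet D →
      Tendsto (fun q => P.real (Q q j ∩ D)) atTop (𝓝 (P.real (S j ∩ D))) := by
    intro j D hD
    refine tendsto_iff_dist_tendsto_zero.2 (squeeze_zero (fun q => dist_nonneg) (fun q => ?_) hzero)
    rw [Real.dist_eq]
    exact (abs_measureReal_inter_sub_le (hSm j) (hQm q j) hD).trans (hGS q j)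
  have hlim' : ∀ j, Tendsto (fun q => P.real (Q q j)) atTop (𝓝 (P.real (S j))) := fun j => by
    simpa only [Set.inter_univ] using hlim j Set.univ MeasurableSet.univ
  -- The finite-dimensional bound does not depend on the dimension, so it survives the limit;
  -- positivity of the blocks keeps the denominators away from zero.
  suffices hfin : Tendsto (fun q => ∑ j, ∑ k, P.real (Q q j ∩ R k) ^ 2 /
      (P.real (Q q j) * P.real (R k))) atTop
      (𝓝 (∑ j, ∑ k, P.real (S j ∩ R k) ^ 2 / (P.real (S j) * P.real (R k)))) from le_of_tendsto' hfin hbound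
  refine tendsto_finsetSum _ fun j _ => tendsto_finsetSum _ fun k _ => ?_
  exact ((hlim j _ (hRm' k)).pow 2).div ((hlim' j).mul_const _)
    (mul_pos (hS.pos j) (hR.pos k)).ne'

lemma sum_measureReal_inter_eq_one {Ω' : Type*} {m l : ℕ} {S : Fin m → Set Ω'}
    {R : Fin l → Set Ω'} {𝒜 ℬ mΩ : MeasurableSpace Ω'} {P : Measure Ω'} [IsProbabilityMeasure P]
    (h𝒜 : 𝒜 ≤ mΩ) (hℬ : ℬ ≤ mΩ) (hS : IsMeasPartition 𝒜 P S) (hR : IsMeasPartition ℬ P R) :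
    ∑ j, ∑ k, P.real (S j ∩ R k) = 1 := by
  have h1 : ∀ j, ∑ k, P.real (S j ∩ R k) = P.real (S j) := by
    intro j
    rw [← measureReal_iUnion_fintype
      (fun i k hik => ((hR.disjoint hik).mono Set.inter_subset_right Set.inter_subset_right))
      fun k => (h𝒜 _ (hS.measurableSet j)).inter (hℬ _ (hR.measurableSet k)), ← Set.inter_iUnion,
      hR.iUnion_eq, Set.inter_univ]
  simp only [h1]
  rw [← measureReal_iUnion_fintype (fun i k hik => hS.disjoint hik)
    fun j => h𝒜 _ (hS.measurableSet j), hS.iUnion_eq, probReal_univ]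

/-- Termwise domination of relative entropy by chi-square divergence, from `log x ≤ x - 1`. -/
lemma mul_log_div_le {p q : ℝ} (hp : 0 ≤ p) (hq : 0 < q) : p * Real.log (p / q) ≤ p ^ 2 / q - p := by
  rcases hp.eq_or_lt with rfl | hp
  · simp
  · have := Real.log_le_sub_one_of_pos (div_pos hp hq)
    calc p * Real.log (p / q) ≤ p * (p / q - 1) := by gcongr
      _ = _ := by ring

/-- The mutual information of two Gaussian spaces is bounded in terms of the Hilbert-Schmidt norm
of the cross-correlation. -/
lemma mutualInfo_le_exp_sub_one {V A B : Submodule ℝ (Lp ℝ 2 P)}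
    [B.HasOrthogonalProjection] (hV : (V : Set (Lp ℝ 2 P)) ⊆ gaussianSet P) (hA : A ≤ V)
    (hB : B ≤ V) {M : ℝ} (hM : M ≤ 1 / 2)
    (hHS : ∀ (N : ℕ) (U : Fin N → Lp ℝ 2 P), (∀ k, U k ∈ A) → Orthonormal ℝ U →
      ∑ k, ‖B.starProjection (U k)‖ ^ 2 ≤ M) :
    mutualInfo (sigmaOf A) (sigmaOf B) P ≤ ((Real.exp (2 * M) - 1 : ℝ) : EReal) := by
  refine sSup_le ?_
  rintro r ⟨m, l, S, R, hS, hR, rfl⟩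
  refine EReal.coe_le_coe_iff.2 ?_
  calc _ ≤ ∑ j, ∑ k, (P.real (S j ∩ R k) ^ 2 / (P.real (S j) * P.real (R k)) -
        P.real (S j ∩ R k)) :=
        Finset.sum_le_sum fun j _ => Finset.sum_le_sum fun k _ =>
          mul_log_div_le measureReal_nonneg (mul_pos (hS.pos j) (hR.pos k))
    _ = ∑ j, ∑ k, P.real (S j ∩ R k) ^ 2 / (P.real (S j) * P.real (R k)) - 1 := by
        simp only [Finset.sum_sub_distrib]
        rw [sum_measureReal_inter_eq_one (sigmaOf_le A) (sigmaOf_le B) hS hR]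
    _ ≤ _ := by
        gcongr
        exact sum_sq_div_le_exp_of_isMeasPartition hV hA hB hM hHS hS hR

lemma mutualInfo_nonneg {Ω' : Type*} (𝒜 ℬ : MeasurableSpace Ω') {mΩ : MeasurableSpace Ω'}
    (P : Measure Ω') [IsProbabilityMeasure P] : 0 ≤ mutualInfo 𝒜 ℬ P := by
  have h : ∀ 𝒞 : MeasurableSpace Ω',
      @IsMeasPartition Ω' 𝒞 mΩ P 1 fun _ : Fin 1 => (Set.univ : Set Ω') := fun 𝒞 =>
    @IsMeasPartition.mk Ω' 𝒞 mΩ P 1 _ (fun _ => @MeasurableSet.univ _ 𝒞)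
      (fun i j hij => absurd (Subsingleton.elim i j) hij) (Set.iUnion_const _)
      fun _ => by rw [@probReal_univ Ω' mΩ P _]; exact one_pos
  refine le_sSup ⟨1, 1, _, _, h 𝒜, h ℬ, ?_⟩
  simp

end MutualInfo

end LevyFBM

end

noncomputable section

set_option linter.unusedSectionVars false

namespace LevyFBM

open scoped RealInnerProductSpace ENNReal NNReal

/-! ### Second differences of the variogram -/

section SecondDifference

/-- Up to sign, `t^p` is strongly convex on a compact interval around `r`; the bound is the midpoint
inequality for it. -/
lemma exists_rpow_second_difference_lower {p r : ℝ} (hp0 : 0 < p) (hp2 : p < 2) (hp1 : p ≠ 1)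
    (hr : 0 < r) :
    ∃ κ : ℝ, 0 < κ ∧ ∀ δ : ℝ, 0 < δ → δ ≤ r / 2 →
      κ * δ ^ 2 ≤ |(r + δ) ^ p + (r - δ) ^ p - 2 * r ^ p| := by
  obtain ⟨σ, hσ1, hσ⟩ : ∃ σ : ℝ, |σ| = 1 ∧ σ * (p - 1) = |p - 1| := by
    rcases le_total 0 (p - 1) with h | h
    · exact ⟨1, by simp, by rw [abs_of_nonneg h, one_mul]⟩
    · exact ⟨-1, by simp, by rw [abs_of_nonpos h]; ring⟩
  have hp1' : 0 < |p - 1| := abs_pos.2 (sub_ne_zero.2 hp1)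
  -- Half the minimum of the absolute second derivative on `D`, attained at the right endpoint since
  -- `p < 2`. Subtracting `κ t²` thus preserves convexity, and that term returns `2κδ²` in the
  -- second difference.
  set κ : ℝ := p * |p - 1| * (3 * r / 2) ^ (p - 2) / 2 with hκ
  have hκ0 : 0 < κ := by positivity
  set D := Set.Icc (r / 2) (3 * r / 2) with hD
  have hpos : ∀ x ∈ D, 0 < x := fun x hx => by have := hx.1; linarith
  have hconv : ConvexOn ℝ D (fun t => σ * t ^ p - κ * t ^ 2) := by
    have hsub : interior D ⊆ D := interior_subset
    refine convexOn_of_hasDerivWithinAt2_nonneg (convex_Icc _ _)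
      (f' := fun t => σ * (p * t ^ (p - 1)) - κ * (2 * t))
      (f'' := fun t => σ * (p * ((p - 1) * t ^ (p - 1 - 1))) - κ * 2) ?_ ?_ ?_ ?_
    · refine ContinuousOn.sub (ContinuousOn.mul continuousOn_const ?_) (by fun_prop)
      exact continuousOn_id.rpow_const fun x hx => Or.inl (hpos x hx).ne'
    · intro x hx
      have h1 := Real.hasDerivAt_rpow_const (p := p) (Or.inl (hpos x (hsub hx)).ne')
      have h2 := hasDerivAt_pow 2 x
      have h3 := (h1.const_mul σ).sub (h2.const_mul κ)
      refine HasDerivAt.hasDerivWithinAt ?_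
      simpa using! h3
    · intro x hx
      have h1 := Real.hasDerivAt_rpow_const (p := p - 1) (Or.inl (hpos x (hsub hx)).ne')
      have h2 := (hasDerivAt_id x).const_mul 2
      have h3 := ((h1.const_mul p).const_mul σ).sub (h2.const_mul κ)
      refine HasDerivAt.hasDerivWithinAt ?_
      simpa using! h3
    · intro x hx
      have hx' := hsub hx
      have h1 : (3 * r / 2) ^ (p - 2) ≤ x ^ (p - 1 - 1) := by
        have : p - 1 - 1 = p - 2 := by ring
        rw [this]
        exact Real.rpow_le_rpow_of_nonpos (hpos x hx') hx'.2 (by linarith)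
      have h2 : σ * (p * ((p - 1) * x ^ (p - 1 - 1))) = p * |p - 1| * x ^ (p - 1 - 1) := by
        rw [← hσ]; ring
      have h3 : κ * 2 = p * |p - 1| * (3 * r / 2) ^ (p - 2) := by rw [hκ]; ring
      rw [h2, h3, sub_nonneg]
      gcongr
  refine ⟨2 * κ, by positivity, fun δ hδ hδr => ?_⟩
  have hx : r + δ ∈ D := ⟨by linarith, by linarith⟩
  have hy : r - δ ∈ D := ⟨by linarith, by linarith⟩
  have h1 := hconv.2 hx hy (by norm_num : (0 : ℝ) ≤ 1 / 2) (by norm_num : (0 : ℝ) ≤ 1 / 2)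
    (by norm_num)
  simp only [smul_eq_mul] at h1
  have h2 : 1 / 2 * (r + δ) + 1 / 2 * (r - δ) = r := by ring
  rw [h2] at h1
  have h3 : 2 * κ * δ ^ 2 ≤ σ * ((r + δ) ^ p + (r - δ) ^ p - 2 * r ^ p) := by
    nlinarith
  calc 2 * κ * δ ^ 2 ≤ |σ * ((r + δ) ^ p + (r - δ) ^ p - 2 * r ^ p)| := h3.trans (le_abs_self _)
    _ = _ := by rw [abs_mul, hσ1, one_mul]

variable {E : Type*} [NormedAddCommGroup E] [InnerProductSpace ℝ E] [FiniteDimensional ℝ E]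

/-- The Hessian of the power of the norm has radial eigenvalue `2H(2H-1)‖z‖^{2H-2}` and tangential
eigenvalue `2H‖z‖^{2H-2}`. The radial direction works unless `H = 1/2`; then a direction orthogonal
to `z` is used. -/
lemma exists_norm_rpow_second_difference_lower {H : ℝ} (hH0 : 0 < H) (hH1 : H < 1)
    (hE : Module.finrank ℝ E ≠ 1 ∨ H ≠ 1 / 2) {z : E} (hz : z ≠ 0) :
    ∃ w : E, ‖w‖ = 1 ∧ ∃ κ : ℝ, 0 < κ ∧ ∃ δ₀ : ℝ, 0 < δ₀ ∧ ∀ δ : ℝ, 0 < δ → δ < δ₀ →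
      κ * δ ^ 2 ≤
        |‖z + δ • w‖ ^ (2 * H) + ‖z - δ • w‖ ^ (2 * H) - 2 * ‖z‖ ^ (2 * H)| := by
  have hr : 0 < ‖z‖ := norm_pos_iff.2 hz
  by_cases hH : H = 1 / 2
  · have hd : Module.finrank ℝ E ≠ 1 := hE.resolve_right (not_not.2 hH)
    have hne : (ℝ ∙ z)ᗮ ≠ ⊥ := by
      intro h
      rw [Submodule.orthogonal_eq_bot_iff] at h
      have := finrank_span_singleton (K := ℝ) hz
      rw [h, finrank_top] at this
      exact hd this
    obtain ⟨u, hu, hu0⟩ := Submodule.exists_mem_ne_zero_of_ne_bot hne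
    have hu' : 0 < ‖u‖ := norm_pos_iff.2 hu0
    have huz : ⟪z, u⟫ = 0 := Submodule.mem_orthogonal_singleton_iff_inner_right.1 hu
    set w := ‖u‖⁻¹ • u with hw
    have hw1 : ‖w‖ = 1 := by
      rw [hw, norm_smul, norm_inv, norm_norm, inv_mul_cancel₀ hu'.ne']
    have hzw : ⟪z, w⟫ = 0 := by rw [hw, real_inner_smul_right, huz, mul_zero]
    -- With `y = √(‖z‖² + δ²)` the second difference is `2(y - ‖z‖) = 2δ²/(y + ‖z‖)`, and `y ≤
    -- 2‖z‖`.
    refine ⟨w, hw1, 2 / (3 * ‖z‖), by positivity, ‖z‖, hr, fun δ hδ hδr => ?_⟩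
    have h1 : ‖z + δ • w‖ ^ 2 = ‖z‖ ^ 2 + δ ^ 2 := by
      rw [norm_add_sq_real, real_inner_smul_right, hzw, norm_smul, hw1, Real.norm_of_nonneg hδ.le]
      ring
    have h2 : ‖z - δ • w‖ ^ 2 = ‖z‖ ^ 2 + δ ^ 2 := by
      rw [norm_sub_sq_real, real_inner_smul_right, hzw, norm_smul, hw1, Real.norm_of_nonneg hδ.le]
      ring
    have h3 : ‖z - δ • w‖ = ‖z + δ • w‖ :=
      (sq_eq_sq₀ (norm_nonneg _) (norm_nonneg _)).1 (h2.trans h1.symm)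
    have h4 : 2 * H = 1 := by rw [hH]; norm_num
    rw [h3, h4, Real.rpow_one, Real.rpow_one]
    refine le_trans ?_ (le_abs_self _)
    set y := ‖z + δ • w‖
    have hy0 : 0 ≤ y := norm_nonneg _
    have hy : y ≤ 2 * ‖z‖ := by nlinarith
    have hyz : ‖z‖ ≤ y := by nlinarith
    rw [div_mul_eq_mul_div, div_le_iff₀ (by positivity)]
    nlinarith
  · obtain ⟨κ, hκ, h⟩ := exists_rpow_second_difference_lower (p := 2 * H) (r := ‖z‖)
      (by positivity) (by linarith) (fun h => hH (by linarith)) hr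
    refine ⟨‖z‖⁻¹ • z, by rw [norm_smul, norm_inv, norm_norm, inv_mul_cancel₀ hr.ne'], κ, hκ,
      ‖z‖ / 2, by positivity, fun δ hδ hδr => ?_⟩
    have h1 : ∀ t : ℝ, |t| ≤ ‖z‖ → ‖z + t • ‖z‖⁻¹ • z‖ = ‖z‖ + t := by
      intro t ht
      have : z + t • ‖z‖⁻¹ • z = ((‖z‖ + t) * ‖z‖⁻¹) • z := by
        rw [smul_smul, add_mul, mul_inv_cancel₀ hr.ne', add_smul, one_smul]
      rw [this, norm_smul, Real.norm_of_nonneg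
        (mul_nonneg (by linarith [neg_abs_le t]) (inv_nonneg.2 hr.le)), mul_assoc,
        inv_mul_cancel₀ hr.ne', mul_one]
    have h2 : ‖z - δ • ‖z‖⁻¹ • z‖ = ‖z‖ - δ := by
      have := h1 (-δ) (by rw [abs_neg, abs_of_pos hδ]; linarith)
      rwa [neg_smul, ← sub_eq_add_neg, ← sub_eq_add_neg] at this
    rw [h1 δ (by rw [abs_of_pos hδ]; linarith), h2]
    exact h δ hδ hδr.le

end SecondDifference

/-! ### Angles -/

section Angle

variable {F : Type*} [NormedAddCommGroup F] [InnerProductSpace ℝ F]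

/-- Changing the sign of `U` changes the sign of the quotient; if one subspace is trivial, the
supremum of the empty set is `0` by convention. -/
lemma cosAngle_nonneg (A B : Submodule ℝ F) : 0 ≤ cosAngle A B := by
  rcases Set.eq_empty_or_nonempty {r : ℝ | ∃ U ∈ A, ∃ V ∈ B, U ≠ 0 ∧ V ≠ 0 ∧
    r = inner ℝ U V / (‖U‖ * ‖V‖)} with h | ⟨r, U, hU, V, hV, hU0, hV0, hr⟩
  · rw [cosAngle, h, Real.sSup_empty]
  · rcases le_total 0 r with h0 | h0
    · exact Real.sSup_nonneg' ⟨r, ⟨U, hU, V, hV, hU0, hV0, hr⟩, h0⟩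
    · refine Real.sSup_nonneg' ⟨-r, ⟨-U, A.neg_mem hU, V, hV, neg_ne_zero.2 hU0, hV0, ?_⟩,
        by linarith⟩
      rw [inner_neg_left, norm_neg, hr, neg_div]

lemma cosAngle_le {A B : Submodule ℝ F} {c : ℝ} (hc : 0 ≤ c)
    (h : ∀ U ∈ A, ∀ V ∈ B, ‖U‖ = 1 → ‖V‖ = 1 → ⟪U, V⟫ ≤ c) : cosAngle A B ≤ c := by
  refine Real.sSup_le ?_ hc
  rintro r ⟨U, hU, V, hV, hU0, hV0, rfl⟩
  have hU1 : 0 < ‖U‖ := norm_pos_iff.2 hU0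
  have hV1 : 0 < ‖V‖ := norm_pos_iff.2 hV0
  have := h (‖U‖⁻¹ • U) (A.smul_mem _ hU) (‖V‖⁻¹ • V) (B.smul_mem _ hV)
    (by rw [norm_smul, norm_inv, norm_norm, inv_mul_cancel₀ hU1.ne'])
    (by rw [norm_smul, norm_inv, norm_norm, inv_mul_cancel₀ hV1.ne'])
  rw [real_inner_smul_left, real_inner_smul_right] at this
  refine (le_of_eq ?_).trans this
  field_simp

lemma abs_inner_div_le_cosAngle {A B : Submodule ℝ F} {U V : F} (hU : U ∈ A) (hV : V ∈ B)
    (hU0 : U ≠ 0) (hV0 : V ≠ 0) : |⟪U, V⟫| / (‖U‖ * ‖V‖) ≤ cosAngle A B := by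
  have hbdd : BddAbove {r : ℝ | ∃ U ∈ A, ∃ V ∈ B, U ≠ 0 ∧ V ≠ 0 ∧
      r = inner ℝ U V / (‖U‖ * ‖V‖)} := by
    refine ⟨1, ?_⟩
    rintro r ⟨U, -, V, -, -, -, rfl⟩
    exact (le_abs_self _).trans (abs_real_inner_div_norm_mul_norm_le_one U V)
  rcases abs_cases ⟪U, V⟫ with ⟨h, -⟩ | ⟨h, -⟩
  · exact le_csSup hbdd ⟨U, hU, V, hV, hU0, hV0, by rw [h]⟩
  · exact le_csSup hbdd ⟨-U, A.neg_mem hU, V, hV, neg_ne_zero.2 hU0, hV0,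
      by rw [h, inner_neg_left, norm_neg]⟩

end Angle

end LevyFBM

end

noncomputable section

set_option linter.unusedSectionVars false

namespace LevyFBM

open scoped RealInnerProductSpace ENNReal NNReal

/-! ### Increment spaces of Lévy fractional Brownian motion -/

variable {Ω : Type*} [MeasurableSpace Ω] {P : Measure Ω} [IsProbabilityMeasure P] {n : ℕ} {H : ℝ}
  {X : EuclideanSpace ℝ (Fin n) → Ω → ℝ}

lemma IsLevyFBM.memLp (hX : IsLevyFBM H X P) (u : EuclideanSpace ℝ (Fin n)) : MemLp (X u) 2 P :=
  (hX.isGaussianProcess.hasGaussianLaw_eval u).memLp_two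

/-- The class of `X u` in `L²(P)`. -/
def IsLevyFBM.toLp (hX : IsLevyFBM H X P) (u : EuclideanSpace ℝ (Fin n)) : Lp ℝ 2 P :=
  (hX.memLp u).toLp

lemma IsLevyFBM.coeFn_toLp (hX : IsLevyFBM H X P) (u : EuclideanSpace ℝ (Fin n)) :
    hX.toLp u =ᵐ[P] X u :=
  (hX.memLp u).coeFn_toLp

lemma IsLevyFBM.inner_toLp (hX : IsLevyFBM H X P) (u v : EuclideanSpace ℝ (Fin n)) :
    ⟪hX.toLp u, hX.toLp v⟫ =
      (1 / 2 : ℝ) * (‖u‖ ^ (2 * H) + ‖v‖ ^ (2 * H) - ‖u - v‖ ^ (2 * H)) := by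
  rw [inner_Lp_eq_integral, ← hX.covariance_eq]
  refine integral_congr_ae ?_
  filter_upwards [hX.coeFn_toLp u, hX.coeFn_toLp v] with ω h1 h2
  rw [h1, h2]

/-- The linear combination of the variables `X u` with the given coefficients. -/
def IsLevyFBM.wiener (hX : IsLevyFBM H X P) :
    (EuclideanSpace ℝ (Fin n) →₀ ℝ) →ₗ[ℝ] Lp ℝ 2 P :=
  Finsupp.linearCombination ℝ hX.toLp

lemma IsLevyFBM.wiener_apply (hX : IsLevyFBM H X P) (a : EuclideanSpace ℝ (Fin n) →₀ ℝ) :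
    hX.wiener a = ∑ u ∈ a.support, a u • hX.toLp u := rfl

lemma IsLevyFBM.wiener_single_sub (hX : IsLevyFBM H X P) (u v : EuclideanSpace ℝ (Fin n)) :
    hX.wiener (Finsupp.single u 1 - Finsupp.single v 1) = hX.toLp u - hX.toLp v := by
  simp [IsLevyFBM.wiener]

/-- The parts of the covariance depending on one index only are annihilated by the zero mass in the
other index. -/
lemma IsLevyFBM.isVariogramMap (hX : IsLevyFBM H X P) : IsVariogramMap H hX.wiener := by
  intro a ha b hb
  have ha0 := (mem_massZero.1 ha).2
  have hb0 := (mem_massZero.1 hb).2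
  rw [hX.wiener_apply, hX.wiener_apply, sum_inner]
  simp only [inner_sum, real_inner_smul_left, real_inner_smul_right, hX.inner_toLp]
  have h : ∀ i j, b j * (a i * ((1 / 2 : ℝ) * (‖i‖ ^ (2 * H) + ‖j‖ ^ (2 * H)
      - ‖i - j‖ ^ (2 * H)))) = 1 / 2 * (a i * ‖i‖ ^ (2 * H)) * b j
        + a i * (1 / 2 * (b j * ‖j‖ ^ (2 * H)))
        + -(1 / 2) * (a i * b j * ‖i - j‖ ^ (2 * H)) := fun i j => by ring
  simp only [h, Finset.sum_add_distrib, ← Finset.mul_sum, ← Finset.sum_mul, ha0, hb0]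
  ring

lemma single_sub_single_mem_massZero {E : Type*} [NormedAddCommGroup E] {S : Set E}
    {u v : E} (hu : u ∈ S) (hv : v ∈ S) :
    (Finsupp.single u 1 - Finsupp.single v 1 : E →₀ ℝ) ∈ massZero S := by
  refine ⟨Submodule.sub_mem _ ?_ ?_, ?_⟩
  · exact Finsupp.single_mem_supported ℝ 1 hu
  · exact Finsupp.single_mem_supported ℝ 1 hv
  · simp [LinearMap.mem_ker]

lemma IsLevyFBM.sub_mem_incrementSpace (hX : IsLevyFBM H X P) {S : Set (EuclideanSpace ℝ (Fin n))}
    {u v : EuclideanSpace ℝ (Fin n)} (hu : u ∈ S) (hv : v ∈ S) :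
    hX.toLp u - hX.toLp v ∈ incrementSpace X P S := by
  refine Submodule.le_topologicalClosure _ (Submodule.subset_span ⟨u, hu, v, hv, ?_⟩)
  filter_upwards [Lp.coeFn_sub (hX.toLp u) (hX.toLp v), hX.coeFn_toLp u, hX.coeFn_toLp v]
    with ω h1 h2 h3
  rw [h1, Pi.sub_apply, h2, h3]

/-- This inclusion suffices, since the correlation estimates are upper bounds valid on the larger
space. -/
lemma IsLevyFBM.incrementSpace_le (hX : IsLevyFBM H X P) (S : Set (EuclideanSpace ℝ (Fin n))) :
    incrementSpace X P S ≤ ((massZero S).map hX.wiener).topologicalClosure := by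
  refine Submodule.topologicalClosure_mono (Submodule.span_le.2 ?_)
  rintro h ⟨u, hu, v, hv, huv⟩
  refine ⟨_, single_sub_single_mem_massZero hu hv, ?_⟩
  rw [hX.wiener_single_sub]
  refine Lp.ext ?_
  filter_upwards [Lp.coeFn_sub (hX.toLp u) (hX.toLp v), hX.coeFn_toLp u, hX.coeFn_toLp v, huv]
    with ω h1 h2 h3 h4
  rw [h1, Pi.sub_apply, h2, h3, h4]

lemma IsLevyFBM.wiener_mem_gaussianSet (hX : IsLevyFBM H X P)
    (a : EuclideanSpace ℝ (Fin n) →₀ ℝ) : hX.wiener a ∈ gaussianSet P := by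
  have h1 : hX.wiener a =ᵐ[P] fun ω => ∑ u ∈ a.support, a u * X u ω := by
    have h2 : ∀ᵐ ω ∂P, ∀ u ∈ a.support, hX.toLp u ω = X u ω :=
      (ae_ball_iff a.support.countable_toSet).2 fun u _ => hX.coeFn_toLp u
    rw [hX.wiener_apply]
    filter_upwards [coeFn_sum_smul a.support a hX.toLp, h2] with ω h3 h4
    rw [h3]
    exact Finset.sum_congr rfl fun u hu => by rw [h4 u hu]
  refine mem_gaussianSet_of_hasGaussianLaw ?_ ?_
  · refine HasGaussianLaw.congr ?_ h1.symm
    exact (hX.isGaussianProcess.smul a).hasGaussianLaw_fun_sum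
  · rw [integral_congr_ae h1, integral_finsetSum]
    · refine Finset.sum_eq_zero fun u _ => ?_
      rw [integral_const_mul, hX.centered, mul_zero]
    · exact fun u _ => ((hX.memLp u).integrable one_le_two).const_mul _

/-- Supplies a single Gaussian space containing both increment spaces, as needed for their joint
Gaussianity. -/
lemma IsLevyFBM.closure_range_subset_gaussianSet (hX : IsLevyFBM H X P) :
    ((LinearMap.range hX.wiener).topologicalClosure : Set (Lp ℝ 2 P)) ⊆ gaussianSet P := by
  refine closure_minimal ?_ isClosed_gaussianSet
  rintro _ ⟨a, rfl⟩
  exact hX.wiener_mem_gaussianSet a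

lemma IsLevyFBM.incrementSpace_le_closure_range (hX : IsLevyFBM H X P)
    (S : Set (EuclideanSpace ℝ (Fin n))) :
    incrementSpace X P S ≤ (LinearMap.range hX.wiener).topologicalClosure :=
  (hX.incrementSpace_le S).trans (Submodule.topologicalClosure_mono (LinearMap.map_le_range))

instance hasOrthogonalProjection_incrementSpace (S : Set (EuclideanSpace ℝ (Fin n))) :
    (incrementSpace X P S).HasOrthogonalProjection := by
  have : CompleteSpace (incrementSpace X P S) :=
    (Submodule.isClosed_topologicalClosure _).completeSpace_coe
  infer_instance

/-- The Hilbert-Schmidt norm of the projection between the increment spaces of two small balls is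
`O(ε ^ (2 - 2 * H))`. -/
lemma IsLevyFBM.exists_sum_sq_norm_starProjection_le (hX : IsLevyFBM H X P) (hH0 : 0 < H)
    (hH1 : H < 1) {s₁ s₂ : EuclideanSpace ℝ (Fin n)} (hs : s₁ ≠ s₂) :
    ∃ C : ℝ, 0 < C ∧ ∃ ε₀ : ℝ, 0 < ε₀ ∧ ∀ ε : ℝ, 0 < ε → ε < ε₀ →
      ∀ (N : ℕ) (U : Fin N → Lp ℝ 2 P),
        (∀ k, U k ∈ incrementSpace X P (Metric.ball s₁ ε)) → Orthonormal ℝ U →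
        ∑ k, ‖(incrementSpace X P (Metric.ball s₂ ε)).starProjection (U k)‖ ^ 2 ≤
          C * (ε ^ (2 - 2 * H)) ^ 2 := by
  obtain ⟨C, hC, ε₀, hε₀, h⟩ := exists_sum_sq_inner_le hH0 hH1 hX.isVariogramMap hs
  refine ⟨C, hC, ε₀, hε₀, fun ε hε hε1 N U hU hUo => ?_⟩
  set B := incrementSpace X P (Metric.ball s₂ ε)
  have hmem : ∀ k, B.starProjection (U k) ∈ B := fun k => B.starProjection_apply_mem (U k)
  -- The normalised projection is the test vector whose inner product with `U k` equals the norm of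
  -- the projection; a zero projection is sent to `0`, since `0⁻¹ = 0`.
  have key := h ε hε hε1 N U (fun k => ‖B.starProjection (U k)‖⁻¹ • B.starProjection (U k))
    (fun k => hX.incrementSpace_le _ (hU k))
    (fun k => hX.incrementSpace_le _ (B.smul_mem _ (hmem k))) hUo ?_
  · refine le_trans (le_of_eq (Finset.sum_congr rfl fun k _ => ?_)) key
    have h1 : ⟪U k, B.starProjection (U k)⟫ = ‖B.starProjection (U k)‖ ^ 2 := by
      rw [← real_inner_self_eq_norm_sq, Submodule.inner_starProjection_left_eq_right,
        Submodule.starProjection_eq_self_iff.2 (hmem k)]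
    rw [real_inner_smul_right, h1]
    rcases eq_or_ne ‖B.starProjection (U k)‖ 0 with h0 | h0
    · rw [h0]; simp
    · field_simp
      rfl
  · intro k
    rw [norm_smul, norm_inv, norm_norm]
    exact inv_mul_le_one

/-! ### Two-sided bounds for the cosine -/

lemma IsLevyFBM.exists_cosAngle_le (hX : IsLevyFBM H X P) (hH0 : 0 < H)
    (hH1 : H < 1) {s₁ s₂ : EuclideanSpace ℝ (Fin n)} (hs : s₁ ≠ s₂) :
    ∃ c : ℝ, 0 < c ∧ ∃ ε₀ : ℝ, 0 < ε₀ ∧ ∀ ε : ℝ, 0 < ε → ε < ε₀ →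
      cosAngle (incrementSpace X P (Metric.ball s₁ ε)) (incrementSpace X P (Metric.ball s₂ ε)) ≤
        c * ε ^ (2 - 2 * H) := by
  obtain ⟨C, hC, ε₀, hε₀, h⟩ := exists_sum_sq_inner_le hH0 hH1 hX.isVariogramMap hs
  refine ⟨√C, Real.sqrt_pos.2 hC, ε₀, hε₀, fun ε hε hε1 => cosAngle_le (by positivity) ?_⟩
  intro U hU V hV hU1 hV1
  -- One unit vector is an orthonormal family, so the Hilbert-Schmidt bound with `N = 1` contains
  -- the operator norm bound.
  have h1 := h ε hε hε1 1 (fun _ => U) (fun _ => V) (fun _ => hX.incrementSpace_le _ hU)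
    (fun _ => hX.incrementSpace_le _ hV)
    ⟨fun _ => hU1, fun i j hij => absurd (Subsingleton.elim i j) hij⟩ (fun _ => hV1.le)
  simp only [Finset.univ_unique, Finset.sum_const, Finset.card_singleton, one_smul] at h1
  refine le_of_sq_le_sq ?_ (by positivity)
  rwa [mul_pow, Real.sq_sqrt hC.le]

lemma IsLevyFBM.inner_sub_sub (hX : IsLevyFBM H X P) (u v u' v' : EuclideanSpace ℝ (Fin n)) :
    ⟪hX.toLp u - hX.toLp v, hX.toLp u' - hX.toLp v'⟫ = (1 / 2 : ℝ) *
      (‖u - v'‖ ^ (2 * H) + ‖v - u'‖ ^ (2 * H) - ‖u - u'‖ ^ (2 * H) - ‖v - v'‖ ^ (2 * H)) := by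
  simp only [inner_sub_left, inner_sub_right, hX.inner_toLp]
  ring

lemma IsLevyFBM.norm_sub (hX : IsLevyFBM H X P) (hH0 : 0 < H) (u v : EuclideanSpace ℝ (Fin n)) :
    ‖hX.toLp u - hX.toLp v‖ = ‖u - v‖ ^ H := by
  have h1 : ‖hX.toLp u - hX.toLp v‖ ^ 2 = (‖u - v‖ ^ H) ^ 2 := by
    rw [← real_inner_self_eq_norm_sq, hX.inner_sub_sub, norm_sub_rev v u, sub_self, sub_self,
      norm_zero, Real.zero_rpow (by linarith), ← Real.rpow_mul_natCast (norm_nonneg _)]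
    push_cast
    rw [mul_comm H 2]
    ring
  exact (sq_eq_sq₀ (norm_nonneg _) (by positivity)).1 h1

lemma IsLevyFBM.exists_le_cosAngle (hX : IsLevyFBM H X P) (hH0 : 0 < H)
    (hH1 : H < 1) (hn : n ≠ 1 ∨ H ≠ 1 / 2) {s₁ s₂ : EuclideanSpace ℝ (Fin n)} (hs : s₁ ≠ s₂) :
    ∃ c : ℝ, 0 < c ∧ ∃ ε₀ : ℝ, 0 < ε₀ ∧ ∀ ε : ℝ, 0 < ε → ε < ε₀ →
      c * ε ^ (2 - 2 * H) ≤ cosAngle (incrementSpace X P (Metric.ball s₁ ε))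
        (incrementSpace X P (Metric.ball s₂ ε)) := by
  obtain ⟨w, hw, κ, hκ, δ₀, hδ₀, h⟩ := exists_norm_rpow_second_difference_lower hH0 hH1
    (E := EuclideanSpace ℝ (Fin n)) (by rwa [finrank_euclideanSpace_fin]) (sub_ne_zero.2 hs)
  -- Increments of length `δ = ε/2` stay inside the open balls. The quotient is at least `(κ/2) δ² /
  -- δ^{2H}`, and rewriting `δ` in terms of `ε` produces the power of `1/2`.
  refine ⟨κ / 2 * (1 / 2) ^ (2 - 2 * H), by positivity, 2 * δ₀, by positivity,
    fun ε hε hε1 => ?_⟩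
  have hδ : 0 < ε / 2 := by positivity
  set δ := ε / 2
  have hnw : ‖δ • w‖ = δ := by rw [norm_smul, hw, mul_one, Real.norm_of_nonneg hδ.le]
  have hball : ∀ s : EuclideanSpace ℝ (Fin n), s + δ • w ∈ Metric.ball s ε := fun s => by
    rw [mem_ball_iff_norm, add_sub_cancel_left, hnw]
    exact half_lt_self hε
  have hnorm : ∀ s : EuclideanSpace ℝ (Fin n), ‖hX.toLp (s + δ • w) - hX.toLp s‖ = δ ^ H :=
    fun s => by rw [hX.norm_sub hH0, add_sub_cancel_left, hnw]
  have hne : ∀ s : EuclideanSpace ℝ (Fin n), hX.toLp (s + δ • w) - hX.toLp s ≠ 0 := fun s => by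
    rw [← norm_pos_iff, hnorm]
    positivity
  have h1 := abs_inner_div_le_cosAngle
    (hX.sub_mem_incrementSpace (hball s₁) (Metric.mem_ball_self hε))
    (hX.sub_mem_incrementSpace (hball s₂) (Metric.mem_ball_self hε)) (hne s₁) (hne s₂)
  refine le_trans ?_ h1
  have e1 : s₁ + δ • w - s₂ = s₁ - s₂ + δ • w := by abel
  have e2 : s₁ - (s₂ + δ • w) = s₁ - s₂ - δ • w := by abel
  have e3 : s₁ + δ • w - (s₂ + δ • w) = s₁ - s₂ := by abel
  have h2 := h δ hδ (by simp only [δ]; linarith)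
  have h3 : κ / 2 * δ ^ 2 ≤ |⟪hX.toLp (s₁ + δ • w) - hX.toLp s₁,
      hX.toLp (s₂ + δ • w) - hX.toLp s₂⟫| := by
    rw [hX.inner_sub_sub, e1, e2, e3, abs_mul, abs_of_pos (by norm_num : (0 : ℝ) < 1 / 2)]
    have e4 : ‖s₁ - s₂ + δ • w‖ ^ (2 * H) + ‖s₁ - s₂ - δ • w‖ ^ (2 * H) - ‖s₁ - s₂‖ ^ (2 * H)
        - ‖s₁ - s₂‖ ^ (2 * H) = ‖s₁ - s₂ + δ • w‖ ^ (2 * H) + ‖s₁ - s₂ - δ • w‖ ^ (2 * H)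
        - 2 * ‖s₁ - s₂‖ ^ (2 * H) := by ring
    rw [e4]
    linarith
  rw [hnorm, hnorm, le_div_iff₀ (by positivity), ← Real.rpow_add hδ]
  refine le_trans (le_of_eq ?_) h3
  rw [mul_assoc, mul_assoc, ← mul_assoc ((1 / 2 : ℝ) ^ _), ← Real.mul_rpow (by norm_num) hε.le,
    one_div_mul_eq_div, ← Real.rpow_add hδ, ← Real.rpow_natCast]
  congr 2
  push_cast
  ring

/-! ### Asymptotic independence in the weak and the strong sense -/

lemma tendsto_rpow_nhdsGT_zero {p : ℝ} (hp : 0 < p) :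
    Tendsto (fun ε : ℝ => ε ^ p) (𝓝[>] 0) (𝓝 0) := by
  have h := (Real.continuousAt_rpow_const 0 p (Or.inr hp.le)).tendsto
  rw [Real.zero_rpow hp.ne'] at h
  exact h.mono_left nhdsWithin_le_nhds

lemma IsLevyFBM.tendsto_angle (hX : IsLevyFBM H X P) (hH0 : 0 < H)
    (hH1 : H < 1) {s₁ s₂ : EuclideanSpace ℝ (Fin n)} (hs : s₁ ≠ s₂) :
    Tendsto (fun ε : ℝ => angle (incrementSpace X P (Metric.ball s₁ ε))
      (incrementSpace X P (Metric.ball s₂ ε))) (𝓝[>] 0) (𝓝 (Real.pi / 2)) := by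
  obtain ⟨c, -, ε₀, hε₀, h⟩ := hX.exists_cosAngle_le hH0 hH1 hs
  have h1 : Tendsto (fun ε : ℝ => cosAngle (incrementSpace X P (Metric.ball s₁ ε))
      (incrementSpace X P (Metric.ball s₂ ε))) (𝓝[>] 0) (𝓝 0) := by
    have h2 := (tendsto_rpow_nhdsGT_zero (p := 2 - 2 * H) (by linarith)).const_mul c
    rw [mul_zero] at h2
    refine tendsto_of_tendsto_of_tendsto_of_le_of_le' tendsto_const_nhds h2
      (Eventually.of_forall fun ε => cosAngle_nonneg _ _) ?_
    filter_upwards [Ioo_mem_nhdsGT hε₀] with ε hε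
    exact h ε hε.1 hε.2
  rw [← Real.arccos_zero]
  exact (Real.continuous_arccos.tendsto 0).comp h1

lemma IsLevyFBM.tendsto_mutualInfo (hX : IsLevyFBM H X P) (hH0 : 0 < H)
    (hH1 : H < 1) {s₁ s₂ : EuclideanSpace ℝ (Fin n)} (hs : s₁ ≠ s₂) :
    Tendsto (fun ε : ℝ => mutualInfo (sigmaOf (incrementSpace X P (Metric.ball s₁ ε)))
      (sigmaOf (incrementSpace X P (Metric.ball s₂ ε))) P) (𝓝[>] 0) (𝓝 0) := by
  obtain ⟨C, -, ε₀, hε₀, h⟩ := hX.exists_sum_sq_norm_starProjection_le hH0 hH1 hs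
  have h1 : Tendsto (fun ε : ℝ => C * (ε ^ (2 - 2 * H)) ^ 2) (𝓝[>] 0) (𝓝 0) := by
    have := ((tendsto_rpow_nhdsGT_zero (p := 2 - 2 * H) (by linarith)).pow 2).const_mul C
    simpa using this
  have h2 : Tendsto (fun ε : ℝ => ((Real.exp (2 * (C * (ε ^ (2 - 2 * H)) ^ 2)) - 1 : ℝ) : EReal))
      (𝓝[>] 0) (𝓝 0) := by
    rw [← EReal.coe_zero, EReal.tendsto_coe]
    have h3 := ((Real.continuous_exp.tendsto _).comp (h1.const_mul 2)).sub_const 1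
    simpa using! h3
  refine tendsto_of_tendsto_of_tendsto_of_le_of_le' tendsto_const_nhds h2
    (Eventually.of_forall fun ε => mutualInfo_nonneg _ _ P) ?_
  filter_upwards [Ioo_mem_nhdsGT hε₀, h1.eventually_le_const (by norm_num : (0 : ℝ) < 1 / 2)]
    with ε hε hM
  exact mutualInfo_le_exp_sub_one hX.closure_range_subset_gaussianSet
    (hX.incrementSpace_le_closure_range _) (hX.incrementSpace_le_closure_range _) hM
    (h ε hε.1 hε.2)

end LevyFBM

end

theorem mainTheorem4 {Ω : Type*} [MeasurableSpace Ω] (P : Measure Ω) [IsProbabilityMeasure P]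
    (n : ℕ) (H : ℝ) (hH0 : 0 < H) (hH1 : H < 1)
    (X : EuclideanSpace ℝ (Fin n) → Ω → ℝ) (hX : LevyFBM.IsLevyFBM H X P)
    (s₁ s₂ : EuclideanSpace ℝ (Fin n)) (hs : s₁ ≠ s₂) :
    Tendsto (fun ε : ℝ => LevyFBM.angle
        (LevyFBM.incrementSpace X P (Metric.ball s₁ ε))
        (LevyFBM.incrementSpace X P (Metric.ball s₂ ε))) (𝓝[>] 0) (𝓝 (Real.pi / 2)) ∧
    Tendsto (fun ε : ℝ => LevyFBM.mutualInfo
        (LevyFBM.sigmaOf (LevyFBM.incrementSpace X P (Metric.ball s₁ ε)))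
        (LevyFBM.sigmaOf (LevyFBM.incrementSpace X P (Metric.ball s₂ ε))) P) (𝓝[>] 0) (𝓝 0) ∧
    ∃ c₁ c₂ ε₀ : ℝ, 0 < c₁ ∧ 0 < c₂ ∧ 0 < ε₀ ∧ ∀ ε : ℝ, 0 < ε → ε < ε₀ →
      ((n ≠ 1 ∨ H ≠ 1 / 2) → c₁ * ε ^ (2 - 2 * H) ≤ LevyFBM.cosAngle
        (LevyFBM.incrementSpace X P (Metric.ball s₁ ε))
        (LevyFBM.incrementSpace X P (Metric.ball s₂ ε))) ∧
      LevyFBM.cosAngle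
        (LevyFBM.incrementSpace X P (Metric.ball s₁ ε))
        (LevyFBM.incrementSpace X P (Metric.ball s₂ ε)) ≤ c₂ * ε ^ (2 - 2 * H) := by
  refine ⟨hX.tendsto_angle hH0 hH1 hs, hX.tendsto_mutualInfo hH0 hH1 hs, ?_⟩
  obtain ⟨c₂, hc₂, ε₂, hε₂, h2⟩ := hX.exists_cosAngle_le hH0 hH1 hs
  by_cases hn : n ≠ 1 ∨ H ≠ 1 / 2
  · obtain ⟨c₁, hc₁, ε₁, hε₁, h1⟩ := hX.exists_le_cosAngle hH0 hH1 hn hs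
    exact ⟨c₁, c₂, min ε₁ ε₂, hc₁, hc₂, lt_min hε₁ hε₂, fun ε hε hε' =>
      ⟨fun _ => h1 ε hε (hε'.trans_le (min_le_left _ _)),
        h2 ε hε (hε'.trans_le (min_le_right _ _))⟩⟩
  -- In the exceptional case the lower bound is not claimed, so any positive `c₁` serves.
  · exact ⟨1, c₂, ε₂, one_pos, hc₂, hε₂, fun ε hε hε' => ⟨fun h => absurd h hn, h2 ε hε hε'⟩⟩
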